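/- Let $V$ be a finite set of symbols and let $\mathbb{R}_{\ge 0}^{\infty} = \mathbb{R}_{\ge 0}\cup\{\infty\}$. An $\mathbb{R}_{\ge 0}V$-automaton $\mathcal{A} = (Q, M, I, F)$ consists of a finite non-empty set $Q$ of states, a matrix $M$ indexed by $Q\times Q$, a row vector $I$ and a column vector $F$ indexed by $Q$, all with entries in the set $\{rX \mid r\in\mathbb{R}_{\ge 0},\, X\in V\}\cup\mathbb{R}_{\ge 0}$ of formal power series in commuting symbols from $V$ with coefficients in $\mathbb{R}_{\ge 0}^{\infty}$. Its behavior is the formal power series $[\![\mathcal{A}]\!] = I\,\bigl(\sum_{n\in\mathbb{N}} M^n\bigr)\,F$, whose coefficient at $\sigma\in\mathbb{N}^V$ is written $[\![\mathcal{A}]\!](\sigma)\in\mathbb{R}_{\ge 0}^{\infty}$. **Lemma.** There is a deterministic (multi-stack) Turing machine which, given the binary encoding of an $\mathbb{R}_{\ge 0}V$-automaton $\mathcal{A}$ all of whose coefficients $r$ are rational numbers, outputs the exact mass $$\sum_{\sigma\in\mathbb{N}^V} [\![\mathcal{A}]\!](\sigma)\ \in\ \mathbb{R}_{\ge 0}^{\infty},$$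 and whose running time is bounded by a polynomial in the length of the encoding of $\mathcal{A}$. Here $Q = \{0,\dots,n-1\}$ and $V=\{0,\dots,k-1\}$, where $n\ge 1$ and $k\ge 0$ are part of the input; a rational number is given as a fraction $p/q$ of natural numbers in binary with $q > 0$ (not necessarily in lowest terms); and the output is such a fraction or the value $\infty$. In particular, the mass is always rational or $\infty$. -/

import Mathlib

open scoped ENNReal NNReal

noncomputable section

namespace PGA

/-! ### Weighted automata -/

/-- A `Δ`-automaton over the semiring `S` with state set `Q`: a transition matrix, a row vector of
initial weights and a column vector of final weights, all with entries in `Δ`. -/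
structure WeightedAutomaton {S : Type*} (Δ : Set S) (Q : Type*) [Fintype Q] [Nonempty Q] where
  transition : Matrix Q Q S
  initial : Q → S
  final : Q → S
  transition_mem : ∀ s t, transition s t ∈ Δ
  initial_mem : ∀ s, initial s ∈ Δ
  final_mem : ∀ s, final s ∈ Δ

/-- The set `{rX | r ∈ ℝ≥0, X ∈ V} ∪ ℝ≥0` of formal power series with coefficients in `ℝ≥0∞` in the
commuting symbols `V`. -/
def weightSet (V : Type*) : Set (MvPowerSeries V ℝ≥0∞) :=
  {f | ∃ (r : ℝ≥0) (X : V), f = MvPowerSeries.monomial (Finsupp.single X 1) (r : ℝ≥0∞)} ∪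
    {f | ∃ r : ℝ≥0, f = MvPowerSeries.monomial 0 (r : ℝ≥0∞)}

/-- `M^* = ∑ n, M ^ n`. Infinite sums of formal power series over `ℝ≥0∞` are coefficientwise. -/
def matrixStar {V Q : Type*} [Fintype Q] [DecidableEq Q]
    (M : Matrix Q Q (MvPowerSeries V ℝ≥0∞)) : Matrix Q Q (MvPowerSeries V ℝ≥0∞) :=
  fun s t => fun v => ∑' n : ℕ, MvPowerSeries.coeff v ((M ^ n) s t)

/-- The behavior `I M^* F` of an automaton over the formal power series. -/
def behavior {V Q : Type*} [Fintype Q] [Nonempty Q] [DecidableEq Q]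
    {Δ : Set (MvPowerSeries V ℝ≥0∞)} (A : WeightedAutomaton Δ Q) : MvPowerSeries V ℝ≥0∞ :=
  ∑ s, ∑ t, A.initial s * matrixStar A.transition s t * A.final t

/-- The total mass of the behavior. For finite `V`, the type `V →₀ ℕ` is `ℕ^V`. -/
def mass {V Q : Type*} [Fintype Q] [Nonempty Q] [DecidableEq Q]
    {Δ : Set (MvPowerSeries V ℝ≥0∞)} (A : WeightedAutomaton Δ Q) : ℝ≥0∞ :=
  ∑' v : V →₀ ℕ, MvPowerSeries.coeff v (behavior A)

/-! ### Rational data -/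

/-- A nonnegative rational number, presented as a fraction (not necessarily in lowest terms). -/
structure Fraction where
  num : ℕ
  den : ℕ
  den_pos : 0 < den

/-- The number that a fraction presents. -/
def Fraction.toNNReal (q : Fraction) : ℝ≥0 := (q.num : ℝ≥0) / (q.den : ℝ≥0)

/-- A presentation of an element `r` (`symbol = none`) or `rX` (`symbol = some X`) of
`weightSet (Fin k)` with rational `r`. -/
structure RationalWeight (k : ℕ) where
  coefficient : Fraction
  symbol : Option (Fin k)

/-- The formal power series that is presented. -/
def RationalWeight.toSeries {k : ℕ} (w : RationalWeight k) : MvPowerSeries (Fin k) ℝ≥0∞ :=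
  match w.symbol with
  | none => MvPowerSeries.monomial 0 (w.coefficient.toNNReal : ℝ≥0∞)
  | some X => MvPowerSeries.monomial (Finsupp.single X 1) (w.coefficient.toNNReal : ℝ≥0∞)

theorem RationalWeight.toSeries_mem {k : ℕ} (w : RationalWeight k) :
    w.toSeries ∈ weightSet (Fin k) := by
  obtain ⟨q, _ | X⟩ := w
  · exact Or.inr ⟨q.toNNReal, rfl⟩
  · exact Or.inl ⟨q.toNNReal, X, rfl⟩

/-- A finite presentation of an automaton with rational weights whose states are
`0, …, numStates - 1` and whose symbols are `0, …, numSymbols - 1`. -/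
structure RationalAutomaton where
  numStates : ℕ
  numStates_pos : 0 < numStates
  numSymbols : ℕ
  transition : Fin numStates → Fin numStates → RationalWeight numSymbols
  initial : Fin numStates → RationalWeight numSymbols
  final : Fin numStates → RationalWeight numSymbols

instance (A : RationalAutomaton) : Nonempty (Fin A.numStates) := ⟨⟨0, A.numStates_pos⟩⟩

/-- The automaton that is presented. -/
def RationalAutomaton.toAutomaton (A : RationalAutomaton) :
    WeightedAutomaton (weightSet (Fin A.numSymbols)) (Fin A.numStates) where
  transition s t := (A.transition s t).toSeries
  initial s := (A.initial s).toSeries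
  final s := (A.final s).toSeries
  transition_mem s t := (A.transition s t).toSeries_mem
  initial_mem s := (A.initial s).toSeries_mem
  final_mem s := (A.final s).toSeries_mem

/-- The result of a computation: a fraction, or `none` for `∞`. -/
abbrev ExtFraction := Option Fraction

/-- The element of `ℝ≥0∞` that is presented. -/
def ExtFraction.toENNReal : ExtFraction → ℝ≥0∞
  | none => ∞
  | some q => (q.toNNReal : ℝ≥0∞)

/-! ### Binary encodings -/

/-- A list of natural numbers as a word: each number in binary, followed by a comma. -/
def encodeNats (l : List ℕ) : List Computability.Γ' :=
  l.flatMap fun a => (Computability.encodeNat a).map Computability.Γ'.bit ++ [Computability.Γ'.comma]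

/-- Numerator, denominator, and the symbol (`0` for no symbol, `X + 1` for the symbol `X`). -/
def RationalWeight.toNats {k : ℕ} (w : RationalWeight k) : List ℕ :=
  [w.coefficient.num, w.coefficient.den, w.symbol.elim 0 fun X => (X : ℕ) + 1]

/-- The encoding of an automaton: the numbers of states and of symbols, the initial weights, the
final weights, and the transition matrix row by row. -/
def RationalAutomaton.encode (A : RationalAutomaton) : List Computability.Γ' :=
  encodeNats <|
    [A.numStates, A.numSymbols] ++
    (List.ofFn fun s => (A.initial s).toNats).flatten ++
    (List.ofFn fun s => (A.final s).toNats).flatten ++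
    (List.ofFn fun s => (List.ofFn fun t => (A.transition s t).toNats).flatten).flatten

/-- The encoding of a result: numerator and denominator, where `1 / 0` stands for `∞`. -/
def ExtFraction.encode : ExtFraction → List Computability.Γ'
  | none => encodeNats [1, 0]
  | some q => encodeNats [q.num, q.den]

end PGA

end

/-! Replacing every symbol by 1, that is, summing all coefficients, is a semiring homomorphism on
power series over [0,∞] that commutes with the infinite sum of matrix powers (`coeffSum`,
`mass_toAutomaton`). So the mass is the sum of all I Pᵐ F for a nonnegative rational matrix P. With
one more index n, whose row is I and whose column is F, it becomes the component at n of the least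
solution of a linear system over [0,∞] (`sol_eq_tsum_mulVec`).

Gaussian elimination solves such a system, where a diagonal entry a contributes (1 - a)⁻¹, the sum
of the powers of a (`sol_insert`, `elims_eq_sol`). An entry a ≥ 1 produces ∞, which might still be
multiplied by 0 later. Therefore the indices that are not reached from n, or from which n is not
reached, are cut off beforehand (`trim`), by a Boolean transitive closure that follows the zero
pattern of the elimination. After this, a pivot a ≥ 1 forces the mass to be ∞
(`sol_eq_top_of_pivot`), and without such a pivot the whole computation stays rational.

To keep the numbers short, the elimination is fraction-free in the manner of Bareiss. With the
system written as N / D, every entry that occurs is, up to a diagonal term, a minor of D - N. Hence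
the divisions are exact (`Invariant.succ`), and the Leibniz bound on determinants leaves
polynomially many digits (`abs_minor_le`, `Invariant.entry_le`).

For the machine, a structured language over five stacks is compiled to `FinTM2` step by step
(`Exec.steps`). Data are binary trees in prefix notation, which is self-delimiting, and `PolyTime`
asks for a program that replaces the top tree in polynomial time whatever lies below it. This class
is closed under composition, pairing, case distinction and folds whose intermediate states have
polynomially bounded size (`PolyTime.foldl`). Binary arithmetic, table operations, transitive
closure and elimination are all assembled from these. Loops over the states are affordable, although
their number is given in binary, because the encoding lists more numbers than there are states. -/

namespace StackMachine

/-! ### Structured stack programs and their semantics -/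

open Computability Turing Turing.TM2

/-- The stacks of the machine: input and output, the main stack that holds the data, two auxiliary
stacks and a counter. -/
inductive Stack
  | io
  | main
  | fst
  | snd
  | ctr
  deriving DecidableEq

instance : Fintype Stack :=
  ⟨{.io, .main, .fst, .snd, .ctr}, fun x => by cases x <;> decide⟩

/-- The contents of the stacks. -/
structure Stacks where
  io : List Γ'
  main : List Γ'
  fst : List Γ'
  snd : List Γ'
  ctr : List Γ'

namespace Stacks

def get (s : Stacks) : Stack → List Γ'
  | .io => s.io
  | .main => s.main
  | .fst => s.fst
  | .snd => s.snd
  | .ctr => s.ctr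

def set (s : Stacks) (k : Stack) (l : List Γ') : Stacks :=
  match k with
  | .io => { s with io := l }
  | .main => { s with main := l }
  | .fst => { s with fst := l }
  | .snd => { s with snd := l }
  | .ctr => { s with ctr := l }

theorem get_set (s : Stacks) (k : Stack) (l : List Γ') :
    (s.set k l).get = Function.update s.get k l := by
  funext j
  cases k <;> cases j <;> rfl

end Stacks

/-- Structured programs over the stacks. `pop` branches on the popped symbol; `loop` pops a symbol
and leaves the loop if `exit` holds for it, and runs the body for this symbol and repeats
otherwise. -/
inductive Prog
  | skip
  | push (k : Stack) (a : Γ')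
  | pop (k : Stack) (f : Option Γ' → Prog)
  | seq (p q : Prog)
  | loop (k : Stack) (exit : Option Γ' → Bool) (body : Option Γ' → Prog)

/-- `Exec p s t n`: the program `p` started on `s` ends on `t` after exactly `n` steps. -/
inductive Exec : Prog → Stacks → Stacks → ℕ → Prop
  | skip (s) : Exec .skip s s 1
  | push (k a s) : Exec (.push k a) s (s.set k (a :: s.get k)) 1
  | pop {k f s t n} (h : Exec (f (s.get k).head?) (s.set k (s.get k).tail) t n) :
      Exec (.pop k f) s t (n + 1)
  | seq {p q s t u m n} (hp : Exec p s t m) (hq : Exec q t u n) : Exec (.seq p q) s u (m + n)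
  | loop_exit {k e b} (s : Stacks) (h : e (s.get k).head? = true) :
      Exec (.loop k e b) s (s.set k (s.get k).tail) 1
  | loop_step {k e b s t u m n} (h : e (s.get k).head? = false)
      (hb : Exec (b (s.get k).head?) (s.set k (s.get k).tail) t m)
      (hl : Exec (.loop k e b) t u n) : Exec (.loop k e b) s u (m + n + 1)

/-! ### Compilation -/

/-- The labels of the compiled program. -/
def Label : Prog → Type
  | .skip => Unit
  | .push _ _ => Unit
  | .pop _ f => Unit ⊕ Σ x : Option Γ', Label (f x)
  | .seq p q => Label p ⊕ Label q
  | .loop _ _ b => Unit ⊕ Σ x : Option Γ', Label (b x)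

theorem finite_label : ∀ p : Prog, Finite (Label p)
  | .skip => inferInstanceAs (Finite Unit)
  | .push _ _ => inferInstanceAs (Finite Unit)
  | .pop _ f =>
    have := fun x => finite_label (f x)
    inferInstanceAs (Finite (Unit ⊕ Σ x : Option Γ', Label (f x)))
  | .seq p q =>
    have := finite_label p
    have := finite_label q
    inferInstanceAs (Finite (Label p ⊕ Label q))
  | .loop _ _ b =>
    have := fun x => finite_label (b x)
    inferInstanceAs (Finite (Unit ⊕ Σ x : Option Γ', Label (b x)))

/-- The label at which the program starts. -/
def start : ∀ p : Prog, Label p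
  | .skip => ()
  | .push _ _ => ()
  | .pop _ _ => Sum.inl ()
  | .seq p _ => Sum.inl (start p)
  | .loop _ _ _ => Sum.inl ()

/-- The statements of the compiled program, whose labels are embedded by `e` in the labels of a
machine and which continues at the label `x`. -/
def code {Λ : Type} : ∀ p : Prog, (Label p → Λ) → Λ → Label p →
    Stmt (fun _ : Stack => Γ') Λ (Option Γ')
  | .skip, _, x, _ => .goto fun _ => x
  | .push k a, _, x, _ => .push k (fun _ => a) (.goto fun _ => x)
  | .pop k f, e, _, Sum.inl () =>
    .pop k (fun _ o => o) (.goto fun o => e (Sum.inr ⟨o, start (f o)⟩))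
  | .pop _ f, e, x, Sum.inr ⟨o, l⟩ => code (f o) (fun l => e (Sum.inr ⟨o, l⟩)) x l
  | .seq p q, e, _, Sum.inl l => code p (fun l => e (Sum.inl l)) (e (Sum.inr (start q))) l
  | .seq _ q, e, x, Sum.inr l => code q (fun l => e (Sum.inr l)) x l
  | .loop k t b, e, x, Sum.inl () =>
    .pop k (fun _ o => o) (.goto fun o => if t o then x else e (Sum.inr ⟨o, start (b o)⟩))
  | .loop _ _ b, e, _, Sum.inr ⟨o, l⟩ =>
    code (b o) (fun l => e (Sum.inr ⟨o, l⟩)) (e (Sum.inl ())) l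

/-- `t` steps lead from `c` to `d`. -/
def Steps {Λ : Type} (M : Λ → Stmt (fun _ : Stack => Γ') Λ (Option Γ')) (t : ℕ)
    (c d : Cfg (fun _ : Stack => Γ') Λ (Option Γ')) : Prop :=
  (flip bind (step M))^[t] (some c) = some d

theorem Steps.trans {Λ : Type} {M : Λ → Stmt (fun _ : Stack => Γ') Λ (Option Γ')} {m n : ℕ}
    {c d e} (h : Steps M m c d) (h' : Steps M n d e) : Steps M (m + n) c e := by
  unfold Steps at *
  rw [Nat.add_comm, Function.iterate_add_apply, h, h']

theorem Steps.one {Λ : Type} {M : Λ → Stmt (fun _ : Stack => Γ') Λ (Option Γ')} {c d}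
    (h : step M c = some d) : Steps M 1 c d := h

theorem Steps.of_label {Λ : Type} {M : Λ → Stmt (fun _ : Stack => Γ') Λ (Option Γ')} {l q v S d}
    (h : M l = q) (hd : stepAux q v S = d) : Steps M 1 ⟨some l, v, S⟩ d := by
  subst h hd
  rfl

/-- The machine is only required to agree with the compiled code on the image of `e`, so the
induction hypothesis applies to subprograms inside a larger machine. The register is arbitrary at
both ends: it only carries a popped symbol to the jump that follows within the same step. -/
theorem Exec.steps {Λ : Type} (M : Λ → Stmt (fun _ : Stack => Γ') Λ (Option Γ')) {p s t n}
    (h : Exec p s t n) (e : Label p → Λ) (x : Λ) (hM : ∀ l, M (e l) = code p e x l)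
    (v : Option Γ') :
    ∃ v', Steps M n ⟨some (e (start p)), v, s.get⟩ ⟨some x, v', t.get⟩ := by
  induction h generalizing x v with
  | skip s => exact ⟨v, .of_label (hM ()) rfl⟩
  | push k a s =>
    refine ⟨v, .of_label (hM ()) ?_⟩
    rw [Stacks.get_set]
    rfl
  | @pop k f s t n h ih =>
    obtain ⟨v', hv⟩ := ih (fun l => e (Sum.inr ⟨_, l⟩)) x (fun l => hM _) (s.get k).head?
    refine ⟨v', ?_⟩
    rw [Nat.add_comm]
    refine (Steps.of_label (hM (Sum.inl ())) ?_).trans hv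
    rw [Stacks.get_set]
    rfl
  | @seq p q s t u m n hp hq ihp ihq =>
    obtain ⟨v', hv⟩ := ihp (fun l => e (Sum.inl l)) (e (Sum.inr (start q))) (fun l => hM _) v
    obtain ⟨v'', hv'⟩ := ihq (fun l => e (Sum.inr l)) x (fun l => hM _) v'
    exact ⟨v'', hv.trans hv'⟩
  | @loop_exit k t b s h =>
    refine ⟨(s.get k).head?, .of_label (hM (Sum.inl ())) ?_⟩
    rw [Stacks.get_set]
    simp only [code, stepAux, h, if_true]
  | @loop_step k t b s s' u m n h hb hl ihb ihl =>
    obtain ⟨v', hv⟩ := ihb (fun l => e (Sum.inr ⟨_, l⟩)) (e (Sum.inl ())) (fun l => hM _)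
      (s.get k).head?
    obtain ⟨v'', hv'⟩ := ihl e x hM v'
    refine ⟨v'', ?_⟩
    rw [Nat.add_comm, ← Nat.add_assoc, Nat.add_comm 1, Nat.add_comm m 1]
    refine ((Steps.of_label (hM (Sum.inl ())) ?_).trans hv).trans hv'
    rw [Stacks.get_set]
    simp [code, stepAux, h]

/-- The Turing machine that runs a program. -/
noncomputable def toFinTM2 (p : Prog) : FinTM2 where
  K := Stack
  k₀ := .io
  k₁ := .io
  Γ _ := Γ'
  Λ := Option (Label p)
  main := some (start p)
  ΛFin := have := finite_label p; Fintype.ofFinite _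
  σ := Option Γ'
  initialState := none
  m
    | some l => code p some none l
    | none => .load (fun _ => none) .halt

/-- The additional step is taken at the exit label `none`; it resets the register to its initial
value, as `haltList` demands, and halts. -/
theorem outputs_of_exec {p : Prog} {x y : List Γ'} {n : ℕ}
    (h : Exec p ⟨x, [], [], [], []⟩ ⟨y, [], [], [], []⟩ n) :
    Nonempty (TM2OutputsInTime (toFinTM2 p) x (some y) (n + 1)) := by
  obtain ⟨v, hv⟩ := h.steps (toFinTM2 p).m some none (fun l => rfl) none
  refine ⟨⟨⟨n + 1, ?_⟩, le_rfl⟩⟩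
  have hi : initList (toFinTM2 p) x =
      ⟨some (some (start p)), none, Stacks.get ⟨x, [], [], [], []⟩⟩ := by
    unfold initList
    congr 1
    funext k
    cases k <;> rfl
  have hf : haltList (toFinTM2 p) y = ⟨none, none, Stacks.get ⟨y, [], [], [], []⟩⟩ := by
    unfold haltList
    congr 1
    funext k
    cases k <;> rfl
  have := hv.trans (e := ⟨none, none, Stacks.get ⟨y, [], [], [], []⟩⟩) (.one rfl)
  change _ = some (haltList (toFinTM2 p) y)
  exact Eq.trans (congrArg _ (congrArg some hi)) (Eq.trans this (congrArg some hf.symm))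

/-! ### Bounded running times -/

/-- The program `p` started on `s` ends on `t` after at most `n` steps. -/
def Runs (p : Prog) (s t : Stacks) (n : ℕ) : Prop := ∃ m ≤ n, Exec p s t m

namespace Runs

theorem mono {p s t m n} (h : Runs p s t m) (hmn : m ≤ n) : Runs p s t n :=
  let ⟨k, hk, e⟩ := h
  ⟨k, hk.trans hmn, e⟩

theorem skip (s) : Runs .skip s s 1 := ⟨1, le_rfl, .skip s⟩

theorem push (k a s) : Runs (.push k a) s (s.set k (a :: s.get k)) 1 := ⟨1, le_rfl, .push k a s⟩

theorem pop {k f s t n} (h : Runs (f (s.get k).head?) (s.set k (s.get k).tail) t n) :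
    Runs (.pop k f) s t (n + 1) :=
  let ⟨m, hm, e⟩ := h
  ⟨m + 1, by omega, .pop e⟩

theorem seq {p q s t u m n} (hp : Runs p s t m) (hq : Runs q t u n) :
    Runs (.seq p q) s u (m + n) :=
  let ⟨_, h, e⟩ := hp
  let ⟨_, h', e'⟩ := hq
  ⟨_, by omega, .seq e e'⟩

theorem loop_exit {k e b} (s : Stacks) (h : e (s.get k).head? = true) :
    Runs (.loop k e b) s (s.set k (s.get k).tail) 1 := ⟨1, le_rfl, .loop_exit s h⟩

theorem loop_step {k e b s t u m n} (h : e (s.get k).head? = false)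
    (hb : Runs (b (s.get k).head?) (s.set k (s.get k).tail) t m)
    (hl : Runs (.loop k e b) t u n) : Runs (.loop k e b) s u (m + n + 1) :=
  let ⟨_, h', e'⟩ := hb
  let ⟨_, h'', e''⟩ := hl
  ⟨_, by omega, .loop_step h e' e''⟩

end Runs

end StackMachine

namespace StackMachine

open Computability Turing Turing.TM2

/-! ### Trees on the main stack -/

/-- Binary trees, the data of the programs. -/
inductive Data
  | nil
  | node (x y : Data)

namespace Data

/-- Prefix notation. -/
def word : Data → List Γ'
  | nil => [.bit false]
  | node x y => .bit true :: (x.word ++ y.word)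

def size (x : Data) : ℕ := x.word.length

theorem size_nil : size nil = 1 := rfl

theorem size_node (x y : Data) : size (node x y) = x.size + y.size + 1 := by
  simp [size, word]

theorem size_pos (x : Data) : 0 < x.size := by cases x <;> simp [size, word]

end Data

/-- The stacks with a given main stack and auxiliary stacks. -/
abbrev St (m a b : List Γ') : Stacks := ⟨[], m, a, b, []⟩

/-- The loop of `move`: the counter holds the number of trees that are still to be moved. -/
def moveLoop (k : Stack) : Prog :=
  .loop .ctr Option.isNone fun _ => .pop .main fun
    | some (.bit true) =>
      .seq (.push k (.bit true)) (.seq (.push .ctr .blank) (.push .ctr .blank))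
    | some x => .push k x
    | none => .skip

/-- Move the top tree of the main stack to the stack `k`, reversed. -/
def move (k : Stack) : Prog := .seq (.push .ctr .blank) (moveLoop k)

/-- The prefix word of a tree delimits itself: a leaf uses up one counter symbol, and an inner node
replaces one by two. The run that follows is a hypothesis, so that the induction can chain the two
subtrees. An inner node costs the full 5 steps. -/
theorem runs_moveLoop_fst {r a b c t n} (x : Data)
    (h : Runs (moveLoop .fst) ⟨[], r, x.word.reverse ++ a, b, c⟩ t n) :
    Runs (moveLoop .fst) ⟨[], x.word ++ r, a, b, .blank :: c⟩ t (n + 5 * x.size) := by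
  induction x generalizing r a c t n with
  | nil =>
    exact (Runs.loop_step (m := 2) rfl (.pop (.push _ _ _)) h).mono
      (by simp [Data.size_nil]; omega)
  | node x y ihx ihy =>
    have h1 := @ihx (y.word ++ r) (.bit true :: a) (.blank :: c) t _ (@ihy _ _ _ _ _ (by
      simpa [Data.word] using h))
    rw [show (Data.node x y).word ++ r = .bit true :: (x.word ++ (y.word ++ r)) by simp [Data.word]]
    exact (Runs.loop_step (m := 4) rfl
      (.pop (.seq (.push _ _ _) (.seq (.push _ _ _) (.push _ _ _)))) h1).mono
      (by rw [Data.size_node]; omega)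

theorem runs_moveLoop_snd {r a b c t n} (x : Data)
    (h : Runs (moveLoop .snd) ⟨[], r, a, x.word.reverse ++ b, c⟩ t n) :
    Runs (moveLoop .snd) ⟨[], x.word ++ r, a, b, .blank :: c⟩ t (n + 5 * x.size) := by
  induction x generalizing r b c t n with
  | nil =>
    exact (Runs.loop_step (m := 2) rfl (.pop (.push _ _ _)) h).mono
      (by simp [Data.size_nil]; omega)
  | node x y ihx ihy =>
    have h1 := @ihx (y.word ++ r) (.bit true :: b) (.blank :: c) t _ (@ihy _ _ _ _ _ (by
      simpa [Data.word] using h))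
    rw [show (Data.node x y).word ++ r = .bit true :: (x.word ++ (y.word ++ r)) by simp [Data.word]]
    exact (Runs.loop_step (m := 4) rfl
      (.pop (.seq (.push _ _ _) (.seq (.push _ _ _) (.push _ _ _)))) h1).mono
      (by rw [Data.size_node]; omega)

theorem runs_move_fst (x : Data) (r a b : List Γ') :
    Runs (move .fst) (St (x.word ++ r) a b) (St r (x.word.reverse ++ a) b) (5 * x.size + 2) :=
  (Runs.seq (.push _ _ _) (runs_moveLoop_fst x (.loop_exit _ rfl))).mono (by omega)

theorem runs_move_snd (x : Data) (r a b : List Γ') :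
    Runs (move .snd) (St (x.word ++ r) a b) (St r a (x.word.reverse ++ b)) (5 * x.size + 2) :=
  (Runs.seq (.push _ _ _) (runs_moveLoop_snd x (.loop_exit _ rfl))).mono (by omega)

/-- Empty the stack `k` and run `p` for each symbol. -/
def pour (k : Stack) (p : Γ' → Prog) : Prog :=
  .loop k Option.isNone fun
    | some x => p x
    | none => .skip

theorem runs_pour_fst_main (u m b : List Γ') :
    Runs (pour .fst (.push .main)) (St m u b) (St (u.reverse ++ m) [] b) (2 * u.length + 1) := by
  induction u generalizing m with
  | nil => exact .loop_exit _ rfl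
  | cons x u ih =>
    rw [List.reverse_cons, List.append_assoc]
    exact (Runs.loop_step (m := 1) rfl (.push _ _ _) (ih _)).mono (by simp; omega)

theorem runs_pour_snd_main (u m a : List Γ') :
    Runs (pour .snd (.push .main)) (St m a u) (St (u.reverse ++ m) a []) (2 * u.length + 1) := by
  induction u generalizing m with
  | nil => exact .loop_exit _ rfl
  | cons x u ih =>
    rw [List.reverse_cons, List.append_assoc]
    exact (Runs.loop_step (m := 1) rfl (.push _ _ _) (ih _)).mono (by simp; omega)

theorem runs_pour_fst_skip (u m b : List Γ') :
    Runs (pour .fst fun _ => .skip) (St m u b) (St m [] b) (2 * u.length + 1) := by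
  induction u with
  | nil => exact .loop_exit _ rfl
  | cons x u ih => exact (Runs.loop_step (m := 1) rfl (.skip _) ih).mono (by simp; omega)

theorem runs_pour_fst_both (u m b : List Γ') :
    Runs (pour .fst fun x => .seq (.push .main x) (.push .snd x)) (St m u b)
      (St (u.reverse ++ m) [] (u.reverse ++ b)) (3 * u.length + 1) := by
  induction u generalizing m b with
  | nil => exact .loop_exit _ rfl
  | cons x u ih =>
    rw [List.reverse_cons, List.append_assoc, List.append_assoc]
    exact (Runs.loop_step (m := 2) rfl (.seq (.push _ _ _) (.push _ _ _)) (ih _ _)).mono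
      (by simp; omega)

theorem runs_pour_snd_fst (u m a : List Γ') :
    Runs (pour .snd (.push .fst)) (St m a u) (St m (u.reverse ++ a) []) (2 * u.length + 1) := by
  induction u generalizing a with
  | nil => exact .loop_exit _ rfl
  | cons x u ih =>
    rw [List.reverse_cons, List.append_assoc]
    exact (Runs.loop_step (m := 1) rfl (.push _ _ _) (ih _)).mono (by simp; omega)

/-- Remove the top tree. -/
def drop : Prog := .seq (move .fst) (pour .fst fun _ => .skip)

/-- Duplicate the top tree. -/
def dup : Prog :=
  .seq (move .fst) <| .seq (pour .fst fun x => .seq (.push .main x) (.push .snd x)) <|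
    .seq (pour .snd (.push .fst)) (pour .fst (.push .main))

/-- Exchange the two top trees. -/
def swap : Prog :=
  .seq (move .fst) <| .seq (move .snd) <| .seq (pour .fst (.push .main)) (pour .snd (.push .main))

theorem runs_drop (x : Data) (r : List Γ') :
    Runs drop (St (x.word ++ r) [] []) (St r [] []) (10 * x.size + 10) :=
  ((runs_move_fst x r [] []).seq (runs_pour_fst_skip _ _ _)).mono (by simp [Data.size]; omega)

/-- Each transfer between stacks reverses the word; the detour of the second copy through both
auxiliary stacks restores its orientation. -/
theorem runs_dup (x : Data) (r : List Γ') :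
    Runs dup (St (x.word ++ r) [] []) (St (x.word ++ (x.word ++ r)) [] []) (20 * x.size + 20) := by
  refine ((runs_move_fst x r [] []).seq ((runs_pour_fst_both _ _ _).seq
    ((runs_pour_snd_fst _ _ _).seq (n := 2 * x.size + 1) ?_))).mono
    (by simp [Data.size]; omega)
  simpa [Data.size] using runs_pour_fst_main x.word.reverse (x.word ++ r) []

theorem runs_swap (x y : Data) (r : List Γ') :
    Runs swap (St (x.word ++ (y.word ++ r)) [] []) (St (y.word ++ (x.word ++ r)) [] [])
      (10 * (x.size + y.size) + 20) := by
  refine ((runs_move_fst x _ [] []).seq ((runs_move_snd y _ _ []).seq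
    ((runs_pour_fst_main _ _ _).seq (n := 2 * y.size + 1) ?_))).mono
    (by simp [Data.size]; omega)
  simpa [Data.size] using runs_pour_snd_main y.word.reverse (x.word ++ r) []

end StackMachine

namespace StackMachine

open Computability Turing Turing.TM2

/-! ### Polynomial time functions on encoded data -/

/-- Types whose elements are presented by trees. -/
class Enc (α : Type) where
  enc : α → Data

open Enc (enc)

/-- The size of the presentation. -/
def esize {α : Type} [Enc α] (a : α) : ℕ := (enc a).size

instance : Enc Bool := ⟨fun b => if b then .node .nil .nil else .nil⟩

instance {α β : Type} [Enc α] [Enc β] : Enc (α × β) := ⟨fun p => .node (enc p.1) (enc p.2)⟩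

/-- A nonempty list has the same presentation as the pair of its head and its tail, so `cons` and
`list_cases` need no conversion. -/
instance {α : Type} [Enc α] : Enc (List α) := ⟨List.foldr (fun a t => .node (enc a) t) .nil⟩

instance {α : Type} [Enc α] : Enc (Option α) :=
  ⟨fun o => o.elim .nil fun a => .node (enc a) .nil⟩

instance : Enc ℕ := ⟨fun n => enc n.bits⟩

variable {α β γ δ : Type} [Enc α] [Enc β] [Enc γ] [Enc δ]

theorem enc_pair (a : α) (b : β) : enc (a, b) = .node (enc a) (enc b) := rfl

theorem enc_nil : enc ([] : List α) = .nil := rfl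

theorem enc_cons (a : α) (l : List α) : enc (a :: l) = .node (enc a) (enc l) := rfl

theorem enc_nat (n : ℕ) : enc n = enc n.bits := rfl

theorem esize_pos (a : α) : 0 < esize a := Data.size_pos _

theorem esize_pair (p : α × β) : esize p = esize p.1 + esize p.2 + 1 := Data.size_node _ _

theorem esize_nil : esize ([] : List α) = 1 := rfl

theorem esize_cons (a : α) (l : List α) : esize (a :: l) = esize a + esize l + 1 :=
  Data.size_node _ _

theorem esize_bool_le (b : Bool) : esize b ≤ 3 := by cases b <;> decide

theorem length_lt_esize (l : List α) : l.length < esize l := by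
  induction l with
  | nil => exact esize_pos _
  | cons a l ih => rw [esize_cons, List.length_cons]; omega

theorem esize_le_of_forall_le (l : List α) {m : ℕ} (h : ∀ a ∈ l, esize a ≤ m) :
    esize l ≤ l.length * (m + 1) + 1 := by
  induction l with
  | nil => simp [esize_nil]
  | cons a l ih =>
    rw [esize_cons, List.length_cons, Nat.succ_mul]
    have := ih fun b hb => h b (List.mem_cons_of_mem _ hb)
    have := h a List.mem_cons_self
    omega

theorem esize_append (l m : List α) : esize (l ++ m) + 1 = esize l + esize m := by
  induction l with
  | nil => rw [List.nil_append, esize_nil, Nat.add_comm]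
  | cons a l ih => rw [List.cons_append, esize_cons, esize_cons]; omega

theorem esize_reverse (l : List α) : esize l.reverse = esize l := by
  induction l with
  | nil => rfl
  | cons a l ih =>
    have := esize_append l.reverse [a]
    rw [esize_cons, esize_nil] at this
    rw [List.reverse_cons, esize_cons]
    omega

theorem esize_lt_of_mem {a : α} {l : List α} (h : a ∈ l) : esize a < esize l := by
  induction l with
  | nil => simp at h
  | cons b l ih =>
    rw [esize_cons]
    rcases List.mem_cons.1 h with rfl | h
    · omega
    · have := ih h; omega

/-! ### Polynomial bounds in the size of the data -/

theorem Polynomial.eval_le_eval (q : Polynomial ℕ) {m n : ℕ} (h : m ≤ n) : q.eval m ≤ q.eval n := by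
  rw [Polynomial.eval_eq_sum, Polynomial.eval_eq_sum]
  exact Finset.sum_le_sum fun i _ => Nat.mul_le_mul_left _ (Nat.pow_le_pow_left h i)

/-- `g a` is bounded by a polynomial in the size of `a`. -/
def PolyBounded (g : α → ℕ) : Prop := ∃ q : Polynomial ℕ, ∀ a, g a ≤ q.eval (esize a)

namespace PolyBounded

theorem mono {g h : α → ℕ} (hh : PolyBounded h) (hgh : ∀ a, g a ≤ h a) : PolyBounded g :=
  let ⟨q, hq⟩ := hh
  ⟨q, fun a => (hgh a).trans (hq a)⟩

theorem const (c : ℕ) : PolyBounded fun _ : α => c := ⟨.C c, fun a => by simp⟩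

theorem size : PolyBounded fun a : α => esize a := ⟨.X, fun a => by simp⟩

theorem add {g h : α → ℕ} (hg : PolyBounded g) (hh : PolyBounded h) :
    PolyBounded fun a => g a + h a :=
  let ⟨q, hq⟩ := hg
  let ⟨r, hr⟩ := hh
  ⟨q + r, fun a => by rw [Polynomial.eval_add]; exact Nat.add_le_add (hq a) (hr a)⟩

theorem mul {g h : α → ℕ} (hg : PolyBounded g) (hh : PolyBounded h) :
    PolyBounded fun a => g a * h a :=
  let ⟨q, hq⟩ := hg
  let ⟨r, hr⟩ := hh
  ⟨q * r, fun a => by rw [Polynomial.eval_mul]; exact Nat.mul_le_mul (hq a) (hr a)⟩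

theorem eval {g : α → ℕ} (hg : PolyBounded g) (q : Polynomial ℕ) :
    PolyBounded fun a => q.eval (g a) :=
  let ⟨r, hr⟩ := hg
  ⟨q.comp r, fun a => by rw [Polynomial.eval_comp]; exact Polynomial.eval_le_eval q (hr a)⟩

/-- Substitution of data of polynomially bounded size. -/
theorem comp {g : β → ℕ} (hg : PolyBounded g) {f : α → β}
    (hf : PolyBounded fun a => esize (f a)) : PolyBounded fun a => g (f a) :=
  let ⟨q, hq⟩ := hg
  (hf.eval q).mono fun a => hq (f a)

end PolyBounded

/-- Some program computes `f` in polynomial time: it replaces a presentation of `a` on the top of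
the main stack by a presentation of `f a`. -/
@[fun_prop]
def PolyTime (f : α → β) : Prop :=
  ∃ (p : Prog) (B : α → ℕ), PolyBounded B ∧ ∀ a, esize (f a) ≤ B a ∧
    ∀ r, Runs p (St ((enc a).word ++ r) [] []) (St ((enc (f a)).word ++ r) [] []) (B a)

/-- Remove the top symbol. -/
def popMain : Prog := .pop .main fun _ => .skip

theorem runs_popMain (x : Γ') (m a b : List Γ') : Runs popMain (St (x :: m) a b) (St m a b) 2 :=
  .pop (.skip _)

namespace PolyTime

theorem polyBounded {f : α → β} (h : PolyTime f) : PolyBounded fun a => esize (f a) :=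
  let ⟨_, _, hB, h⟩ := h
  hB.mono fun a => (h a).1

theorem intro {f : α → β} (p : Prog) (B : α → ℕ) (hB : PolyBounded B)
    (hs : ∀ a, esize (f a) ≤ B a)
    (hp : ∀ a r, Runs p (St ((enc a).word ++ r) [] []) (St ((enc (f a)).word ++ r) [] []) (B a)) :
    PolyTime f := ⟨p, B, hB, fun a => ⟨hs a, hp a⟩⟩

/-- Functions that change the type but not the presentation. -/
theorem of_enc_eq {f : α → β} (h : ∀ a, enc (f a) = enc a) : PolyTime f := by
  refine .intro .skip (fun a => 1 + esize a) ((PolyBounded.const 1).add .size) (fun a => ?_)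
    fun a r => ?_
  · rw [esize, h, esize]; omega
  · rw [h]; exact (Runs.skip _).mono (by omega)

@[fun_prop]
theorem id : PolyTime fun a : α => a := of_enc_eq fun _ => rfl

theorem congr {f g : α → β} (h : PolyTime f) (hfg : ∀ a, g a = f a) : PolyTime g := by
  rwa [show g = f from funext hfg]

@[fun_prop]
theorem comp {g : β → γ} {f : α → β} (hg : PolyTime g) (hf : PolyTime f) :
    PolyTime fun a => g (f a) := by
  have hfb := hf.polyBounded
  obtain ⟨p, B, hB, hp⟩ := hf
  obtain ⟨q, C, hC, hq⟩ := hg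
  refine ⟨.seq p q, fun a => B a + C (f a), hB.add (hC.comp hfb), fun a => ⟨?_, fun r => ?_⟩⟩
  · exact (hq (f a)).1.trans (Nat.le_add_left _ _)
  · exact ((hp a).2 r).seq ((hq (f a)).2 r)

/-- Push a word on the main stack. -/
def pushWord : List Γ' → Prog
  | [] => .skip
  | x :: u => .seq (pushWord u) (.push .main x)

theorem runs_pushWord (u m a b : List Γ') :
    Runs (pushWord u) (St m a b) (St (u ++ m) a b) (u.length + 1) := by
  induction u with
  | nil => exact .skip _
  | cons x u ih => exact ih.seq (.push _ _ _)

@[fun_prop]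
theorem const (b : β) : PolyTime fun _ : α => b := by
  refine .intro (.seq drop (pushWord (enc b).word)) (fun a => 10 * esize a + 10 + (esize b + 1))
    ((((PolyBounded.const 10).mul .size).add (.const _)).add (.const _)) (fun a => by omega)
    fun a r => (runs_drop _ _).seq (runs_pushWord _ _ _ _)

@[fun_prop]
theorem fst : PolyTime (Prod.fst : α × β → α) := by
  refine .intro (.seq popMain (.seq swap drop)) (fun p => 20 * esize p + 32)
    (((PolyBounded.const 20).mul .size).add (.const _)) (fun p => ?_) fun p r => ?_
  · rw [esize_pair]; omega
  · obtain ⟨a, b⟩ := p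
    rw [enc_pair, Data.word, List.cons_append, List.append_assoc]
    exact ((runs_popMain _ _ _ _).seq ((runs_swap _ _ _).seq (runs_drop _ _))).mono
      (by rw [esize_pair]; simp only [esize]; omega)

@[fun_prop]
theorem snd : PolyTime (Prod.snd : α × β → β) := by
  refine .intro (.seq popMain drop) (fun p => 20 * esize p + 32)
    (((PolyBounded.const 20).mul .size).add (.const _)) (fun p => ?_) fun p r => ?_
  · rw [esize_pair]; omega
  · obtain ⟨a, b⟩ := p
    rw [enc_pair, Data.word, List.cons_append, List.append_assoc]
    exact ((runs_popMain _ _ _ _).seq (runs_drop _ _)).mono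
      (by rw [esize_pair]; simp only [esize]; omega)

-- `g` consumes the duplicate on top; after the exchange `f` consumes the original, which leaves the
-- two values in the right order for a final node symbol.
@[fun_prop]
theorem pair {f : α → β} {g : α → γ} (hf : PolyTime f) (hg : PolyTime g) :
    PolyTime fun a => (f a, g a) := by
  have hgb := hg.polyBounded
  obtain ⟨p, B, hB, hp⟩ := hf
  obtain ⟨q, C, hC, hq⟩ := hg
  refine .intro (.seq dup (.seq q (.seq swap (.seq p (.push .main (.bit true))))))
    (fun a => (20 * esize a + 20) + (C a + ((10 * (esize (g a) + esize a) + 20) + (B a + 1))))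
    ((((PolyBounded.const 20).mul .size).add (.const _)).add (hC.add
      ((((PolyBounded.const _).mul (hgb.add .size)).add (.const _)).add (hB.add (.const _)))))
    (fun a => ?_) fun a r => ?_
  · have := (hp a).1
    rw [esize_pair]
    dsimp only
    omega
  · have h := ((runs_dup (enc a) r).seq (((hq a).2 _).seq ((runs_swap _ _ _).seq
      (((hp a).2 _).seq (.push .main (.bit true) _)))))
    rw [enc_pair, Data.word, List.cons_append, List.append_assoc]
    exact h

/-- The truth value is computed next to its argument, and its first symbol decides. The tree of
`true` has two further leaves, which must be removed before `q` starts. -/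
theorem ite_bool {c : α → Bool} {f g : α → β} (hc : PolyTime c) (hf : PolyTime f)
    (hg : PolyTime g) : PolyTime fun a => if c a then f a else g a := by
  obtain ⟨p, B, hB, hp⟩ := hc.pair .id
  obtain ⟨q, C, hC, hq⟩ := hf
  obtain ⟨s, D, hD, hs⟩ := hg
  refine .intro (.seq p (.seq popMain (.pop .main fun
    | some (.bit true) => .seq popMain (.seq popMain q)
    | _ => s))) (fun a => B a + (2 + (C a + D a + 4 + 1)))
    (hB.add ((PolyBounded.const _).add (((hC.add hD).add (.const _)).add (.const _))))
    (fun a => ?_) fun a r => ?_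
  · have := (hq a).1
    have := (hs a).1
    split <;> omega
  · have h := (hp a).2 r
    rw [enc_pair, Data.word, List.cons_append, List.append_assoc] at h
    refine h.seq ((runs_popMain _ _ _ _).seq (.pop (n := C a + D a + 4) ?_))
    cases c a
    · exact ((hs a).2 r).mono (by omega)
    · exact ((runs_popMain _ _ _ _).seq ((runs_popMain _ _ _ _).seq ((hq a).2 r))).mono (by omega)

@[fun_prop]
theorem ite {c : α → Prop} [DecidablePred c] {f g : α → β} (hc : PolyTime fun a => decide (c a))
    (hf : PolyTime f) (hg : PolyTime g) : PolyTime fun a => if c a then f a else g a :=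
  (ite_bool hc hf hg).congr fun a => by simp

/-- Case distinction on a list. -/
theorem list_cases {l : α → List β} {f : α → γ} {g : α × β × List β → γ} (hl : PolyTime l)
    (hf : PolyTime f) (hg : PolyTime g) {F : α → γ} (hnil : ∀ a, l a = [] → F a = f a)
    (hcons : ∀ a b t, l a = b :: t → F a = g (a, b, t)) : PolyTime F := by
  have hlb := hl.polyBounded
  obtain ⟨p, B, hB, hp⟩ := hl.pair .id
  obtain ⟨q, C, hC, hq⟩ := hf
  obtain ⟨s, D, ⟨u, hu⟩, hs⟩ := hg
  -- The popped symbol tells whether the list is empty. If not, it is pushed back, the list is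
  -- exchanged with `a`, and a node symbol forms the pair of `a` and the list, which presents `(a,
  -- b, t)`.
  refine .intro (.seq p (.seq popMain (.pop .main fun
    | some (.bit true) =>
      .seq (.push .main (.bit true)) (.seq swap (.seq (.push .main (.bit true)) s))
    | _ => q)))
    (fun a => B a + (2 + (C a + (10 * (esize (l a) + esize a) + 22) +
      u.eval (esize a + esize (l a) + 1) + 1)))
    (hB.add ((PolyBounded.const _).add (((hC.add (((PolyBounded.const _).mul (hlb.add .size)).add
      (.const _))).add (((PolyBounded.size.add hlb).add (.const 1)).eval u)).add (.const _))))
    (fun a => ?_) fun a r => ?_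
  · rcases hla : l a with _ | ⟨b, t⟩
    · rw [hnil a hla]
      have := (hq a).1
      omega
    · rw [hcons a b t hla]
      have hs' := (hs (a, b, t)).1.trans (hu (a, b, t))
      rw [esize_pair, esize_pair (b, t), ← esize_cons b t] at hs'
      dsimp only at hs'
      omega
  · have h := (hp a).2 r
    rw [enc_pair, Data.word, List.cons_append, List.append_assoc] at h
    refine h.seq ((runs_popMain _ _ _ _).seq (.pop (n := C a +
      (10 * (esize (l a) + esize a) + 22) + u.eval (esize a + esize (l a) + 1)) ?_))
    rcases hla : l a with _ | ⟨b, t⟩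
    · rw [hnil a hla]
      exact ((hq a).2 r).mono (by omega)
    · rw [hcons a b t hla]
      have hu' := hu (a, b, t)
      rw [esize_pair, esize_pair (b, t), ← esize_cons b t] at hu'
      have h' := (hs (a, b, t)).2 r
      rw [enc_pair, Data.word, List.cons_append, List.append_assoc, enc_pair] at h'
      refine (Runs.seq (Runs.push _ _ _) ((runs_swap (enc (b :: t)) (enc a) r).seq
        (Runs.seq (.push _ _ _) h'))).mono ?_
      simp only [esize] at *
      omega

end PolyTime

end StackMachine

namespace StackMachine

open Enc (enc)

open Computability Turing Turing.TM2

variable {α β γ δ : Type} [Enc α] [Enc β] [Enc γ] [Enc δ]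

/-! ### Folds over lists -/

namespace PolyTime

/-- The loop of a fold over a list: the list and the state are on the main stack. -/
def foldLoop (p : Prog) : Prog :=
  .loop .main (fun o => o != some (.bit true)) fun _ =>
    .seq (.push .main (.bit true)) (.seq (.push .main (.bit true)) (.seq p popMain))

/-- Popping the node symbol of the list exposes head, tail and state; two pushed node symbols
regroup them as the argument of `p`. The bound `K` is demanded only for states that the fold really
attains, since no uniform bound over all states exists. -/
theorem runs_foldLoop {s : γ → β → γ} {p : Prog} {K : ℕ} (L : List β) : ∀ (c : γ) (r : List Γ'),
    (∀ l' b L', L = l' ++ b :: L' → ∀ r, Runs p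
      (St ((enc ((b, L'), l'.foldl s c)).word ++ r) [] [])
      (St ((enc (L', (l' ++ [b]).foldl s c)).word ++ r) [] []) K) →
    Runs (foldLoop p) (St ((enc L).word ++ ((enc c).word ++ r)) [] [])
      (St ((enc (L.foldl s c)).word ++ r) [] []) (L.length * (K + 5) + 1) := by
  induction L with
  | nil =>
    intro c r _
    exact (Runs.loop_exit (k := .main)
      (St ((enc ([] : List β)).word ++ ((enc c).word ++ r)) [] []) rfl).mono
      (by simp)
  | cons b L ih =>
    intro c r h
    have h1 := h [] b L rfl r
    rw [enc_pair, enc_pair, Data.word, enc_pair, Data.word, Data.word] at h1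
    simp only [List.cons_append, List.append_assoc, List.foldl_nil, List.nil_append,
      List.foldl_cons] at h1
    have h2 := ih (s c b) r fun l' b' L' hL r => by
      simpa using h (b :: l') b' L' (by rw [hL]; rfl) r
    rw [enc_cons, Data.word, List.cons_append, List.append_assoc, List.foldl_cons]
    exact (Runs.loop_step rfl (.seq (.push _ _ _) (.seq (.push _ _ _)
      (.seq h1 (runs_popMain _ _ _ _)))) h2).mono (by rw [List.length_cons, Nat.succ_mul]; omega)

/-- A fold whose states have polynomially bounded size. -/
theorem foldl {l : α → List β} {i : α → γ} {s : α → γ → β → γ} (hl : PolyTime l) (hi : PolyTime i)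
    (hs : PolyTime fun p : α × γ × β => s p.1 p.2.1 p.2.2) {b : α → ℕ} (hb : PolyBounded b)
    (hsb : ∀ a l', l' <+: l a → esize (l'.foldl (s a) (i a)) ≤ b a) :
    PolyTime fun a => (l a).foldl (s a) (i a) := by
  have hlb := hl.polyBounded
  have hinit : PolyTime fun a => (l a, (a, i a)) := by fun_prop
  have hstep : PolyTime fun p : (β × List β) × (α × γ) =>
      (p.1.2, (p.2.1, s p.2.1 p.2.2 p.1.1)) :=
    .pair (by fun_prop) (.pair (by fun_prop)
      (hs.comp (f := fun p : (β × List β) × (α × γ) => (p.2.1, p.2.2, p.1.1)) (by fun_prop)))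
  -- The step depends on `a`, so `a` travels along as part of the state.
  suffices h : PolyTime fun a => (a, (l a).foldl (s a) (i a)) from snd.comp h
  obtain ⟨p, B, hB, hp⟩ := hinit
  obtain ⟨q, C, ⟨u, hu⟩, hq⟩ := hstep
  refine .intro (.seq p (.seq popMain (foldLoop q)))
    (fun a => (B a + (2 + (esize (l a) * (u.eval (esize (l a) + esize a + b a + 2) + 5) + 1))) +
      (esize a + b a + 1))
    ((hB.add ((PolyBounded.const 2).add ((hlb.mul (((((hlb.add .size).add hb).add
      (.const 2)).eval u).add (.const 5))).add (.const 1)))).add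
        ((PolyBounded.size.add hb).add (.const 1))) (fun a => ?_) fun a r => ?_
  · have := hsb a (l a) (List.prefix_refl _)
    rw [esize_pair]
    dsimp only
    omega
  · have h := (hp a).2 r
    rw [enc_pair, Data.word, List.cons_append, List.append_assoc] at h
    have hf : ∀ L : List β, L.foldl (fun (x : α × γ) d => (x.1, s x.1 x.2 d)) (a, i a) =
        (a, L.foldl (s a) (i a)) := by
      intro L
      generalize i a = c
      induction L generalizing c with
      | nil => rfl
      | cons d L ih => exact ih _
    -- In every round the unread list is at most as large as `l a` and the state is bounded by `b
    -- a`; the 2 accounts for the two remaining pair nodes. One value of `u` thus bounds all rounds.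
    have hloop := runs_foldLoop (s := fun (x : α × γ) d => (x.1, s x.1 x.2 d)) (p := q)
      (K := u.eval (esize (l a) + esize a + b a + 2)) (l a) (a, i a) r
      fun l' d L' hL r => by
        rw [hf, hf, List.foldl_append]
        refine ((hq ((d, L'), (a, l'.foldl (s a) (i a)))).2 r).mono
          ((hu _).trans (Polynomial.eval_le_eval u ?_))
        have h1 := esize_append l' (d :: L')
        have h2 := esize_pos l'
        have h3 := hsb a l' ⟨d :: L', hL.symm⟩
        rw [← hL, esize_cons] at h1
        rw [esize_pair, esize_pair, esize_pair]
        dsimp only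
        omega
    rw [hf] at hloop
    refine (h.seq ((runs_popMain _ _ _ _).seq hloop)).mono ?_
    have := Nat.mul_le_mul_right (u.eval (esize (l a) + esize a + b a + 2) + 5)
      (length_lt_esize (l a)).le
    omega

end PolyTime

/-! ### Lists -/

theorem esize_le_of_prefix {l m : List α} (h : l <+: m) : esize l ≤ esize m := by
  obtain ⟨t, rfl⟩ := h
  have := esize_append l t
  have := esize_pos t
  omega

namespace PolyTime

/-- Functions with the same presentation of the values. -/
theorem of_enc_congr {f : α → β} {g : α → γ} (hg : PolyTime g) (h : ∀ a, enc (f a) = enc (g a)) :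
    PolyTime f := by
  obtain ⟨p, B, hB, hp⟩ := hg
  refine .intro p B hB (fun a => ?_) fun a r => ?_
  · rw [esize, h]; exact (hp a).1
  · rw [h]; exact (hp a).2 r

@[fun_prop]
theorem cons {f : α → β} {g : α → List β} (hf : PolyTime f) (hg : PolyTime g) :
    PolyTime fun a => f a :: g a :=
  of_enc_congr (hf.pair hg) fun _ => rfl

@[fun_prop]
theorem some {f : α → β} (hf : PolyTime f) : PolyTime fun a => some (f a) :=
  of_enc_congr (hf.pair (.const ([] : List Bool))) fun _ => rfl

@[fun_prop]
theorem reverse {f : α → List β} (hf : PolyTime f) : PolyTime fun a => (f a).reverse := by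
  refine (foldl (s := fun _ (c : List β) b => b :: c) hf (.const []) (by fun_prop) hf.polyBounded
    fun a l' h => ?_).congr fun a => ?_
  · rw [List.foldl_flip_cons_eq_append', List.append_nil, esize_reverse]
    exact esize_le_of_prefix h
  · rw [List.foldl_flip_cons_eq_append', List.append_nil]

@[fun_prop]
theorem append {f g : α → List β} (hf : PolyTime f) (hg : PolyTime g) :
    PolyTime fun a => f a ++ g a := by
  refine (foldl (s := fun _ (c : List β) b => b :: c) hf.reverse hg (by fun_prop)
    (hf.polyBounded.add hg.polyBounded) fun a l' h => ?_).congr fun a => ?_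
  · rw [List.foldl_flip_cons_eq_append']
    have h1 := esize_le_of_prefix h
    have h2 := esize_append l'.reverse (g a)
    rw [esize_reverse] at h1 h2
    omega
  · rw [List.foldl_flip_cons_eq_append', List.reverse_reverse]

theorem map {l : α → List β} {f : α → β → γ} (hl : PolyTime l)
    (hf : PolyTime fun p : α × β => f p.1 p.2) : PolyTime fun a => (l a).map (f a) := by
  obtain ⟨q, hq⟩ := hf.polyBounded
  have hlb := hl.polyBounded
  refine (foldl (s := fun a (c : List γ) b => f a b :: c) hl (.const [])
    (.cons (hf.comp (f := fun p : α × List γ × β => (p.1, p.2.2)) (by fun_prop)) (by fun_prop))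
    (b := fun a => esize (l a) * (q.eval (esize a + esize (l a) + 1) + 1) + 1)
    ((hlb.mul ((((PolyBounded.size.add hlb).add (.const 1)).eval q).add (.const 1))).add
      (.const 1)) fun a l' h => ?_).reverse.congr fun a => ?_
  · rw [List.foldl_flip_cons_eq_append, List.append_nil, esize_reverse]
    refine (esize_le_of_forall_le _ (m := q.eval (esize a + esize (l a) + 1)) fun c hc => ?_).trans
      (Nat.add_le_add_right (Nat.mul_le_mul_right _ ?_) 1)
    · obtain ⟨b, hb, rfl⟩ := List.mem_map.1 hc
      refine (hq (a, b)).trans (Polynomial.eval_le_eval q ?_)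
      have := esize_lt_of_mem (h.subset hb)
      rw [esize_pair]
      dsimp only
      omega
    · rw [List.length_map]
      exact h.length_le.trans (length_lt_esize _).le
  · rw [List.foldl_flip_cons_eq_append, List.append_nil, List.reverse_reverse]

theorem filter {l : α → List β} {f : α → β → Bool} (hl : PolyTime l)
    (hf : PolyTime fun p : α × β => f p.1 p.2) : PolyTime fun a => (l a).filter (f a) := by
  have h (a : α) (l' c : List β) : l'.foldl (fun c b => if f a b then b :: c else c) c =
      (l'.filter (f a)).reverse ++ c := by
    induction l' generalizing c with
    | nil => rfl
    | cons b l' ih =>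
      rw [List.foldl_cons, ih]
      cases hb : f a b <;> simp [hb]
  refine (foldl (s := fun a (c : List β) b => if f a b then b :: c else c) hl (.const [])
    (.ite_bool (hf.comp (f := fun p : α × List β × β => (p.1, p.2.2)) (by fun_prop))
      (by fun_prop) (by fun_prop)) (b := fun a => esize (l a) * (esize (l a) + 1) + 1)
    ((hl.polyBounded.mul (hl.polyBounded.add (.const 1))).add (.const 1))
    fun a l' hl' => ?_).reverse.congr fun a => ?_
  · rw [h, List.append_nil, esize_reverse]
    refine (esize_le_of_forall_le _ (m := esize (l a)) fun c hc => ?_).trans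
      (Nat.add_le_add_right (Nat.mul_le_mul_right _ ?_) 1)
    · exact (esize_lt_of_mem (hl'.subset (List.mem_of_mem_filter hc))).le
    · exact (List.length_filter_le _ _).trans (hl'.length_le.trans (length_lt_esize _).le)
  · rw [h, List.append_nil, List.reverse_reverse]

/-- Every function of a truth value. -/
theorem of_bool (f : Bool → β) {c : α → Bool} (hc : PolyTime c) : PolyTime fun a => f (c a) :=
  (ite_bool hc (.const (f true)) (.const (f false))).congr fun a => by cases c a <;> rfl

theorem of_bool₃ (f : Bool → Bool → Bool → β) {c d e : α → Bool} (hc : PolyTime c)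
    (hd : PolyTime d) (he : PolyTime e) : PolyTime fun a => f (c a) (d a) (e a) :=
  (ite_bool hc (ite_bool hd (of_bool (f true true) he) (of_bool (f true false) he))
    (ite_bool hd (of_bool (f false true) he) (of_bool (f false false) he))).congr fun a => by
      cases c a <;> cases d a <;> rfl

@[fun_prop]
theorem decide_and {p q : α → Prop} [DecidablePred p] [DecidablePred q]
    (hp : PolyTime fun a => decide (p a)) (hq : PolyTime fun a => decide (q a)) :
    PolyTime fun a => decide (p a ∧ q a) :=
  (ite_bool hp hq (.const false)).congr fun a => by by_cases p a <;> simp [*]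

@[fun_prop]
theorem decide_or {p q : α → Prop} [DecidablePred p] [DecidablePred q]
    (hp : PolyTime fun a => decide (p a)) (hq : PolyTime fun a => decide (q a)) :
    PolyTime fun a => decide (p a ∨ q a) :=
  (ite_bool hp (.const true) hq).congr fun a => by by_cases p a <;> simp [*]

@[fun_prop]
theorem decide_not {p : α → Prop} [DecidablePred p] (hp : PolyTime fun a => decide (p a)) :
    PolyTime fun a => decide (¬p a) :=
  (of_bool not hp).congr fun a => by simp

end PolyTime

end StackMachine

namespace StackMachine

open Enc (enc)

open Computability Turing Turing.TM2

variable {α β γ δ : Type} [Enc α] [Enc β] [Enc γ] [Enc δ]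

/-! ### Natural numbers -/

theorem esize_nat_le_of_lt_two_pow {n b : ℕ} (h : n < 2 ^ b) : esize n ≤ 4 * b + 1 := by
  have h1 : esize n ≤ n.bits.length * (3 + 1) + 1 :=
    esize_le_of_forall_le n.bits fun b _ => esize_bool_le b
  rw [Nat.size_eq_bits_len] at h1
  have := Nat.size_le.2 h
  omega

theorem size_le_esize (n : ℕ) : n.size ≤ esize n := by
  rw [← Nat.size_eq_bits_len]
  exact (length_lt_esize n.bits).le

theorem lt_two_pow_esize (n : ℕ) : n < 2 ^ esize n :=
  n.lt_size_self.trans_le (Nat.pow_le_pow_right (by norm_num) (size_le_esize n))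

theorem esize_nat_le_of_le {m n : ℕ} (h : m ≤ n) : esize m ≤ 4 * esize n + 1 :=
  esize_nat_le_of_lt_two_pow (h.trans_lt (lt_two_pow_esize n))

/-- The number with the given binary digits, the most significant one first. -/
def ofDigits (l : List Bool) : ℕ := l.foldl (fun n b => Nat.bit b n) 0

theorem ofDigits_concat (l : List Bool) (b : Bool) :
    ofDigits (l ++ [b]) = Nat.bit b (ofDigits l) := by
  simp [ofDigits]

theorem ofDigits_lt (l : List Bool) : ofDigits l < 2 ^ l.length := by
  induction l using List.reverseRecOn with
  | nil => simp [ofDigits]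
  | append_singleton l b ih =>
    rw [ofDigits_concat, Nat.bit_val, List.length_append, List.length_singleton, pow_succ]
    cases b <;> simp <;> omega

theorem ofDigits_cons (b : Bool) (l : List Bool) :
    ofDigits (b :: l) = b.toNat * 2 ^ l.length + ofDigits l := by
  induction l using List.reverseRecOn with
  | nil => simp [ofDigits, Nat.bit_val]
  | append_singleton l c ih =>
    rw [← List.cons_append, ofDigits_concat, ofDigits_concat, ih, Nat.bit_val, Nat.bit_val,
      List.length_append, List.length_singleton, pow_succ]
    ring

theorem ofDigits_reverse_bits (n : ℕ) : ofDigits n.bits.reverse = n := by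
  induction n using Nat.binaryRec' with
  | zero => simp [ofDigits]
  | bit b n h ih => rw [Nat.bits_append_bit _ _ h, List.reverse_cons, ofDigits_concat, ih]

namespace PolyTime

theorem bits {f : α → ℕ} (hf : PolyTime f) : PolyTime fun a => (f a).bits :=
  of_enc_congr hf fun _ => rfl

-- Prepending the digit is correct except for the digit 0 in front of the number 0, because
-- `Nat.bits` has no leading zeros. Hence the case distinction on the digits of `g a`.
@[fun_prop]
theorem bit {f : α → Bool} {g : α → ℕ} (hf : PolyTime f) (hg : PolyTime g) :
    PolyTime fun a => Nat.bit (f a) (g a) := by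
  suffices h : PolyTime fun a => (Nat.bit (f a) (g a)).bits from of_enc_congr h fun _ => rfl
  refine list_cases (l := fun a => (g a).bits) hg.bits
    (of_bool (fun b => bif b then [true] else []) hf)
    (g := fun p => f p.1 :: (g p.1).bits)
    (.cons (hf.comp .fst) (hg.bits.comp .fst)) (fun a h => ?_) fun a b t h => ?_
  · have h0 : g a = 0 := by
      by_contra h0
      have := Nat.size_pos.2 (Nat.pos_of_ne_zero h0)
      rw [← Nat.size_eq_bits_len, h] at this
      simp at this
    rw [h0]
    cases f a
    · simp
    · exact Nat.bits_append_bit 0 true fun _ => rfl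
  · refine Nat.bits_append_bit _ _ fun h0 => ?_
    rw [h0] at h
    simp at h

@[fun_prop]
theorem div2 {f : α → ℕ} (hf : PolyTime f) : PolyTime fun a => (f a).div2 := by
  suffices h : PolyTime fun a => (f a).div2.bits from of_enc_congr h fun _ => rfl
  exact list_cases hf.bits (.const []) (g := fun p => p.2.2) (by fun_prop)
    (fun a h => by rw [Nat.div2_bits_eq_tail, h]; rfl)
    fun a b t h => by rw [Nat.div2_bits_eq_tail, h]; rfl

@[fun_prop]
theorem bodd {f : α → ℕ} (hf : PolyTime f) : PolyTime fun a => (f a).bodd :=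
  list_cases hf.bits (.const false) (g := fun p => p.2.1) (by fun_prop)
    (fun a h => by rw [Nat.bodd_eq_bits_head, h]; rfl)
    fun a b t h => by rw [Nat.bodd_eq_bits_head, h]; rfl

@[fun_prop]
theorem ofDigits {f : α → List Bool} (hf : PolyTime f) : PolyTime fun a => ofDigits (f a) :=
  foldl (s := fun _ n b => Nat.bit b n) hf (.const 0) (by fun_prop)
    (((PolyBounded.const 4).mul hf.polyBounded).add (.const 1)) fun a l h =>
    esize_nat_le_of_lt_two_pow ((ofDigits_lt l).trans_le (Nat.pow_le_pow_right (by norm_num)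
      (h.length_le.trans (length_lt_esize _).le)))

end PolyTime

/-! #### Addition and subtraction -/

/-- One step of a digitwise operation on two numbers: the remaining digits of the numbers, the carry
and the digits of the result. The operation computes the next digit and the next carry. -/
def rippleStep (f g : Bool → Bool → Bool → Bool) (s : ℕ × ℕ × Bool × List Bool) :
    ℕ × ℕ × Bool × List Bool :=
  (s.1.div2, s.2.1.div2, g s.1.bodd s.2.1.bodd s.2.2.1, f s.1.bodd s.2.1.bodd s.2.2.1 :: s.2.2.2)

/-- A digitwise operation: the digits of the result and the last carry. -/
def ripple (f g : Bool → Bool → Bool → Bool) (m n : ℕ) : ℕ × ℕ × Bool × List Bool :=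
  (m.bits ++ n.bits ++ [true]).foldl (fun s _ => rippleStep f g s) (m, n, false, [])

theorem foldl_rippleStep (f g : Bool → Bool → Bool → Bool) (l : List Bool) :
    ∀ s : ℕ × ℕ × Bool × List Bool,
      let t := l.foldl (fun s _ => rippleStep f g s) s
      t.1 = s.1 / 2 ^ l.length ∧ t.2.1 = s.2.1 / 2 ^ l.length ∧
      t.2.2.2.length = s.2.2.2.length + l.length := by
  induction l with
  | nil => simp
  | cons b l ih =>
    rintro ⟨m, n, c, o⟩
    have ih := ih (rippleStep f g (m, n, c, o))
    simp only [List.foldl_cons, List.length_cons]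
    refine ⟨ih.1.trans ?_, ih.2.1.trans ?_, ih.2.2.trans ?_⟩
    · simp only [rippleStep]
      rw [Nat.div2_val, Nat.div_div_eq_div_mul, pow_succ']
    · simp only [rippleStep]
      rw [Nat.div2_val, Nat.div_div_eq_div_mul, pow_succ']
    · simp [rippleStep]; omega

/-- The digits produced so far, plus the shifted value of what remains (both numbers and the carry),
is invariant; `h` is the same statement for a single digit. Addition is `u = v = w = 1`, subtraction
is `u = 1`, `v = w = -1`. -/
theorem ripple_spec (f g : Bool → Bool → Bool → Bool) (u v w : ℤ)
    (h : ∀ x y c : Bool, (f x y c).toNat + 2 * w * (g x y c).toNat =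
      u * x.toNat + v * y.toNat + w * c.toNat) (l : List Bool) :
    ∀ s : ℕ × ℕ × Bool × List Bool,
      let t := l.foldl (fun s _ => rippleStep f g s) s
      (ofDigits t.2.2.2 : ℤ) + 2 ^ t.2.2.2.length * (u * t.1 + v * t.2.1 + w * t.2.2.1.toNat) =
      (ofDigits s.2.2.2 : ℤ) + 2 ^ s.2.2.2.length * (u * s.1 + v * s.2.1 + w * s.2.2.1.toNat) := by
  induction l with
  | nil => simp
  | cons b l ih =>
    rintro ⟨m, n, c, o⟩
    refine (ih (rippleStep f g (m, n, c, o))).trans ?_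
    have h1 := h m.bodd n.bodd c
    have h2 := Nat.bodd_add_div2 m
    have h3 := Nat.bodd_add_div2 n
    simp only [rippleStep, ofDigits_cons, List.length_cons, pow_succ]
    zify at h2 h3
    push_cast
    rw [← h2, ← h3]
    linear_combination 2 ^ o.length * h1

/-- The concatenated digits only serve as a clock. Their number, with one additional round, exceeds
both lengths, so both inputs are used up and the sum fits into `L` digits. -/
theorem ripple_eq (f g : Bool → Bool → Bool → Bool) (u v w : ℤ)
    (h : ∀ x y c : Bool, (f x y c).toNat + 2 * w * (g x y c).toNat =
      u * x.toNat + v * y.toNat + w * c.toNat) (m n : ℕ) :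
    ∃ L, m < 2 ^ L ∧ n < 2 ^ L ∧ m + n < 2 ^ L ∧ ofDigits (ripple f g m n).2.2.2 < 2 ^ L ∧
      (ofDigits (ripple f g m n).2.2.2 : ℤ) + 2 ^ L * (w * (ripple f g m n).2.2.1.toNat) =
        u * m + v * n := by
  obtain ⟨h1, h2, h3⟩ := foldl_rippleStep f g (m.bits ++ n.bits ++ [true]) (m, n, false, [])
  have h4 := ripple_spec f g u v w h (m.bits ++ n.bits ++ [true]) (m, n, false, [])
  set L := (m.bits ++ n.bits ++ [true]).length with hL
  have hL' : L = m.size + n.size + 1 := by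
    simp [hL, Nat.size_eq_bits_len, Nat.add_assoc]
  have hm : m < 2 ^ (m.size + n.size) :=
    m.lt_size_self.trans_le (Nat.pow_le_pow_right (by norm_num) (by omega))
  have hn : n < 2 ^ (m.size + n.size) :=
    n.lt_size_self.trans_le (Nat.pow_le_pow_right (by norm_num) (by omega))
  have hL2 : 2 ^ L = 2 ^ (m.size + n.size) * 2 := by rw [hL', pow_succ]
  have hm' : m < 2 ^ L := by omega
  have hn' : n < 2 ^ L := by omega
  rw [show m / 2 ^ L = 0 from Nat.div_eq_of_lt hm'] at h1
  rw [show n / 2 ^ L = 0 from Nat.div_eq_of_lt hn'] at h2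
  have h3' : (ripple f g m n).2.2.2.length = L := by rw [ripple, h3]; simp
  refine ⟨L, hm', hn', by omega, h3' ▸ ofDigits_lt _, ?_⟩
  change (ripple f g m n).1 = _ at h1
  change (ripple f g m n).2.1 = _ at h2
  change (ofDigits (ripple f g m n).2.2.2 : ℤ) + 2 ^ (ripple f g m n).2.2.2.length *
    (u * (ripple f g m n).1 + v * (ripple f g m n).2.1 + w * (ripple f g m n).2.2.1.toNat) = _ at h4
  rw [h1, h2, h3'] at h4
  simpa [ofDigits] using h4

/-- The sum digit and the carry of a full adder, the difference digit and the borrow of a full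
subtractor. -/
def sumDigit (x y c : Bool) : Bool := x ^^ y ^^ c
def carry (x y c : Bool) : Bool := x && y || x && c || y && c
def borrow (x y c : Bool) : Bool := !x && y || !x && c || y && c

theorem ripple_add (m n : ℕ) : ofDigits (ripple sumDigit carry m n).2.2.2 = m + n := by
  obtain ⟨L, hm, hn, hmn, hlt, h⟩ := ripple_eq sumDigit carry 1 1 1 (by decide) m n
  generalize ofDigits (ripple sumDigit carry m n).2.2.2 = r at *
  zify at hmn
  cases hc : (ripple sumDigit carry m n).2.2.1 <;> simp [hc] at h <;> omega

/-- The result digits give a number in [0, 2ᴸ) that differs from m - n by 2ᴸ times the borrow, so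
the last borrow is the sign of the difference. -/
theorem ripple_borrow (m n : ℕ) :
    (ripple sumDigit borrow m n).2.2.1 = decide (m < n) := by
  obtain ⟨L, hm, hn, hmn, hlt, h⟩ := ripple_eq sumDigit borrow 1 (-1) (-1) (by decide) m n
  generalize ofDigits (ripple sumDigit borrow m n).2.2.2 = r at *
  zify at hmn hlt
  cases hc : (ripple sumDigit borrow m n).2.2.1 <;> simp [hc] at h ⊢ <;> omega

theorem ripple_sub (m n : ℕ) : (if (ripple sumDigit borrow m n).2.2.1 then 0 else
    ofDigits (ripple sumDigit borrow m n).2.2.2) = m - n := by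
  obtain ⟨L, hm, hn, hmn, hlt, h⟩ := ripple_eq sumDigit borrow 1 (-1) (-1) (by decide) m n
  rw [ripple_borrow] at h ⊢
  generalize ofDigits (ripple sumDigit borrow m n).2.2.2 = r at *
  zify at hmn hlt
  by_cases hc : m < n <;> simp [hc] at h ⊢ <;> omega

namespace PolyTime

theorem ripple (f g : Bool → Bool → Bool → Bool) {m n : α → ℕ} (hm : PolyTime m)
    (hn : PolyTime n) : PolyTime fun a => ripple f g (m a) (n a) := by
  have hl : PolyTime fun a => (m a).bits ++ (n a).bits ++ [true] :=
    .append (.append hm.bits hn.bits) (.const _)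
  refine foldl (s := fun _ s _ => rippleStep f g s) (i := fun a => (m a, n a, false, [])) hl
    (by fun_prop)
    (.pair (by fun_prop) (.pair (by fun_prop) (.pair (of_bool₃ g (by fun_prop) (by fun_prop)
      (by fun_prop)) (.cons (of_bool₃ f (by fun_prop) (by fun_prop) (by fun_prop))
      (by fun_prop)))))
    (b := fun a => (4 * esize (m a) + 1) + (4 * esize (n a) + 1) + 10 +
      esize ((m a).bits ++ (n a).bits ++ [true]) * 4)
    (((((PolyBounded.const 4).mul hm.polyBounded).add (.const 1)).add
      (((PolyBounded.const 4).mul hn.polyBounded).add (.const 1))).add (.const 10) |>.add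
      (hl.polyBounded.mul (.const 4))) fun a l hl => ?_
  obtain ⟨h1, h2, h3⟩ := foldl_rippleStep f g l (m a, n a, false, [])
  generalize List.foldl _ _ l = t at *
  have h1 := esize_nat_le_of_le (h1.le.trans (Nat.div_le_self _ _))
  have h2 := esize_nat_le_of_le (h2.le.trans (Nat.div_le_self _ _))
  have h4 := esize_le_of_forall_le t.2.2.2 fun b _ => esize_bool_le b
  have h5 := esize_bool_le t.2.2.1
  have h6 := hl.length_le.trans (length_lt_esize _).le
  rw [esize_pair, esize_pair t.2, esize_pair t.2.2]
  simp only [List.length_nil] at h1 h2 h3 h4 ⊢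
  omega

@[fun_prop]
theorem add {m n : α → ℕ} (hm : PolyTime m) (hn : PolyTime n) : PolyTime fun a => m a + n a := by
  have := PolyTime.ripple sumDigit carry hm hn
  exact congr
    (f := fun a => StackMachine.ofDigits (StackMachine.ripple sumDigit carry (m a) (n a)).2.2.2)
    (by fun_prop) fun a => (ripple_add _ _).symm

@[fun_prop]
theorem decide_lt {m n : α → ℕ} (hm : PolyTime m) (hn : PolyTime n) :
    PolyTime fun a => decide (m a < n a) := by
  have := PolyTime.ripple sumDigit borrow hm hn
  exact congr (f := fun a => (StackMachine.ripple sumDigit borrow (m a) (n a)).2.2.1)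
    (by fun_prop) fun a => (ripple_borrow _ _).symm

@[fun_prop]
theorem decide_le {m n : α → ℕ} (hm : PolyTime m) (hn : PolyTime n) :
    PolyTime fun a => decide (m a ≤ n a) :=
  congr (f := fun a => decide ¬(n a < m a)) (by fun_prop) fun a => by simp

@[fun_prop]
theorem decide_eq {m n : α → ℕ} (hm : PolyTime m) (hn : PolyTime n) :
    PolyTime fun a => decide (m a = n a) :=
  congr (f := fun a => decide (m a ≤ n a ∧ n a ≤ m a)) (by fun_prop) fun a => by
    simp [le_antisymm_iff]

@[fun_prop]
theorem sub {m n : α → ℕ} (hm : PolyTime m) (hn : PolyTime n) : PolyTime fun a => m a - n a := by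
  have := PolyTime.ripple sumDigit borrow hm hn
  exact congr (f := fun a => if (StackMachine.ripple sumDigit borrow (m a) (n a)).2.2.1 then 0 else
    StackMachine.ofDigits (StackMachine.ripple sumDigit borrow (m a) (n a)).2.2.2)
    (ite_bool (by fun_prop) (by fun_prop) (by fun_prop)) fun a => (ripple_sub _ _).symm

end PolyTime

/-! #### Multiplication and division -/

theorem foldl_mul (n : ℕ) (l : List Bool) :
    l.foldl (fun c b => Nat.bit false c + if b then n else 0) 0 = n * ofDigits l := by
  induction l using List.reverseRecOn with
  | nil => simp [ofDigits]
  | append_singleton l b ih =>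
    rw [List.foldl_append, ih, ofDigits_concat, List.foldl_cons, List.foldl_nil, Nat.bit_val,
      Nat.bit_val]
    cases b <;> simp <;> ring

/-- One step of long division by `d`: quotient and remainder. -/
def divStep (d : ℕ) (s : ℕ × ℕ) (b : Bool) : ℕ × ℕ :=
  if d ≤ Nat.bit b s.2 then (Nat.bit true s.1, Nat.bit b s.2 - d)
  else (Nat.bit false s.1, Nat.bit b s.2)

/-- The bound on the quotient does not need `0 < d`: it controls the size of the state for every
divisor, so that division by zero can be treated after the fold. -/
theorem foldl_divStep (d : ℕ) (l : List Bool) :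
    (l.foldl (divStep d) (0, 0)).1 * d + (l.foldl (divStep d) (0, 0)).2 = ofDigits l ∧
    (l.foldl (divStep d) (0, 0)).1 < 2 ^ l.length ∧
    (0 < d → (l.foldl (divStep d) (0, 0)).2 < d) := by
  induction l using List.reverseRecOn with
  | nil => simp [ofDigits]
  | append_singleton l b ih =>
    rw [List.foldl_append, ofDigits_concat, List.foldl_cons, List.foldl_nil, List.length_append,
      List.length_singleton, pow_succ]
    generalize List.foldl _ _ l = t at *
    obtain ⟨q, r⟩ := t
    obtain ⟨h1, h2, h3⟩ := ih
    simp only [divStep, Nat.bit_val] at *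
    rw [← h1]
    have h4 := Bool.toNat_lt b
    split
    · refine ⟨?_, by simp; omega, fun hd => ?_⟩
      · zify [‹d ≤ 2 * r + b.toNat›]
        simp
        ring
      · have := h3 hd
        simp only
        omega
    · refine ⟨by simp; ring, by simp; omega, fun hd => by simp only; omega⟩

theorem div_eq_foldl_divStep (n d : ℕ) :
    (if d = 0 then 0 else (n.bits.reverse.foldl (divStep d) (0, 0)).1) = n / d := by
  split
  · simp [*]
  · obtain ⟨h1, -, h3⟩ := foldl_divStep d n.bits.reverse
    rw [ofDigits_reverse_bits] at h1
    have h3 := h3 (by omega)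
    generalize List.foldl _ _ _ = t at *
    rw [← h1, Nat.add_comm, Nat.add_mul_div_right _ _ (by omega), Nat.div_eq_of_lt h3, Nat.zero_add]

namespace PolyTime

@[fun_prop]
theorem mul {m n : α → ℕ} (hm : PolyTime m) (hn : PolyTime n) : PolyTime fun a => m a * n a := by
  have hl := hn.bits.reverse
  refine (foldl (s := fun a c b => Nat.bit false c + if b then m a else 0) (i := fun _ => 0)
    hl (.const _) (.add (by fun_prop) (.ite_bool (by fun_prop)
      (hm.comp .fst) (.const 0))) (b := fun a => 4 * (esize (m a) + esize (n a).bits.reverse) + 1)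
    (((PolyBounded.const 4).mul (hm.polyBounded.add hl.polyBounded)).add (.const 1))
    fun a l h => ?_).congr fun a => ?_
  · rw [foldl_mul]
    refine esize_nat_le_of_lt_two_pow ?_
    rw [pow_add]
    refine Nat.mul_lt_mul'' (lt_two_pow_esize _) ((ofDigits_lt l).trans_le
      (Nat.pow_le_pow_right (by norm_num) (h.length_le.trans (length_lt_esize _).le)))
  · rw [foldl_mul, ofDigits_reverse_bits]

@[fun_prop]
theorem div {m n : α → ℕ} (hm : PolyTime m) (hn : PolyTime n) : PolyTime fun a => m a / n a := by
  have hl := hm.bits.reverse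
  have h : PolyTime fun a => (m a).bits.reverse.foldl (divStep (n a)) (0, 0) := by
    refine foldl (s := fun a c b => divStep (n a) c b) (i := fun _ => (0, 0))
      hl (.const _) (.ite ?_ ?_ ?_)
      (b := fun a => (4 * esize (m a).bits.reverse + 1) + (4 * esize (m a).bits.reverse + 1) + 1)
      ((((PolyBounded.const 4).mul hl.polyBounded).add (.const 1)).add
        (((PolyBounded.const 4).mul hl.polyBounded).add (.const 1)) |>.add (.const 1))
      fun a l h => ?_
    · exact .decide_le (hn.comp .fst) (by fun_prop)
    · exact .pair (by fun_prop) (.sub (by fun_prop) (hn.comp .fst))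
    · fun_prop
    · obtain ⟨h1, h2, -⟩ := foldl_divStep (n a) l
      have h3 : 2 ^ l.length ≤ 2 ^ esize (m a).bits.reverse :=
        Nat.pow_le_pow_right (by norm_num) (h.length_le.trans (length_lt_esize _).le)
      have h4 := ofDigits_lt l
      change esize (l.foldl (divStep (n a)) (0, 0)) ≤ _
      rw [esize_pair]
      have := esize_nat_le_of_lt_two_pow (h2.trans_le h3)
      have := esize_nat_le_of_lt_two_pow (n := (l.foldl (divStep (n a)) (0, 0)).2)
        (b := esize (m a).bits.reverse) (by omega)
      omega
  exact congr (f := fun a => if n a = 0 then 0 else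
    ((m a).bits.reverse.foldl (divStep (n a)) (0, 0)).1) (by fun_prop)
    fun a => (div_eq_foldl_divStep _ _).symm

end PolyTime

end StackMachine

namespace PGA

/-! ### Systems of linear equations over the extended nonnegative reals -/

namespace LinearSystem

variable {ι : Type*}

/-- The matrix `G` with columns in `S`, applied to a vector. -/
noncomputable def act (S : Finset ι) (G : ι → ι → ℝ≥0∞) (v : ι → ℝ≥0∞) (i : ι) : ℝ≥0∞ :=
  ∑ j ∈ S, G i j * v j

/-- The least solution of `x i = ∑ j ∈ S, G i j * x j + G i o`. -/
noncomputable def sol (S : Finset ι) (G : ι → ι → ℝ≥0∞) (o i : ι) : ℝ≥0∞ :=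
  ∑' m : ℕ, (act S G)^[m] (fun i => G i o) i

theorem sol_eq (S : Finset ι) (G : ι → ι → ℝ≥0∞) (o i : ι) :
    sol S G o i = ∑ j ∈ S, G i j * sol S G o j + G i o := by
  rw [sol, tsum_eq_zero_add' ENNReal.summable, add_comm]
  congr 1
  simp only [Function.iterate_succ_apply']
  simp only [act, sol]
  rw [Summable.tsum_finsetSum fun _ _ => ENNReal.summable]
  exact Finset.sum_congr rfl fun j _ => ENNReal.tsum_mul_left

/-- The partial sums stay below every supersolution, by induction. Together with `sol_eq` this is
leastness, and most comparisons below only exhibit a supersolution. -/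
theorem sol_le {S : Finset ι} {G : ι → ι → ℝ≥0∞} {o : ι} {y : ι → ℝ≥0∞}
    (h : ∀ i, ∑ j ∈ S, G i j * y j + G i o ≤ y i) (i : ι) : sol S G o i ≤ y i := by
  refine ENNReal.tsum_le_of_sum_range_le fun m => ?_
  induction m generalizing i with
  | zero => simp
  | succ m ih =>
    rw [Finset.sum_range_succ']
    refine le_trans ?_ (h i)
    simp only [Function.iterate_succ_apply', act]
    rw [Finset.sum_comm]
    refine add_le_add (Finset.sum_le_sum fun j _ => ?_) le_rfl
    rw [← Finset.mul_sum]
    exact mul_le_mul_right (ih j) _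

theorem mul_le_sol {S : Finset ι} {j : ι} (hj : j ∈ S) (G : ι → ι → ℝ≥0∞) (o i : ι) :
    G i j * sol S G o j ≤ sol S G o i := by
  rw [sol_eq S G o i]
  exact (Finset.single_le_sum (f := fun j => G i j * sol S G o j) (fun _ _ => zero_le) hj).trans
    le_self_add

theorem sol_empty (G : ι → ι → ℝ≥0∞) (o i : ι) : sol ∅ G o i = G i o := by
  rw [sol_eq, Finset.sum_empty, zero_add]

/-- Rows of vanishing solutions do not matter. -/
theorem sol_zero_rows (S : Finset ι) (G : ι → ι → ℝ≥0∞) (o : ι) {H : ι → ι → ℝ≥0∞}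
    (h₀ : ∀ i, sol S G o i = 0 → ∀ j, H i j = 0)
    (h₁ : ∀ i, sol S G o i ≠ 0 → ∀ j, H i j = G i j) : sol S H o = sol S G o := by
  have hle : ∀ i, sol S H o i ≤ sol S G o i := by
    refine sol_le fun i => ?_
    by_cases hi : sol S G o i = 0
    · simp [h₀ i hi]
    · simp only [h₁ i hi]
      exact (sol_eq S G o i).ge
  refine funext fun i => (hle i).antisymm (sol_le (fun i => ?_) i)
  by_cases hi : sol S G o i = 0
  -- At such an index the row of `G`, applied to the smaller vector `sol S H o`, is at most `sol S G
  -- o i = 0`.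
  · refine le_trans ?_ (zero_le (a := sol S H o i))
    rw [← hi, sol_eq S G o i]
    exact add_le_add (Finset.sum_le_sum fun j _ => mul_le_mul_right (hle j) _) le_rfl
  · rw [sol_eq S H o i]
    simp only [h₁ i hi]
    exact le_rfl

theorem sum_mul_act_iterate (S : Finset ι) (G : ι → ι → ℝ≥0∞) (m : ℕ) (v w : ι → ℝ≥0∞) :
    ∑ j ∈ S, v j * (act S G)^[m] w j = ∑ j ∈ S, (act S fun i j => G j i)^[m] v j * w j := by
  induction m generalizing v with
  | zero => rfl
  | succ m ih =>
    rw [Function.iterate_succ_apply' (act S G) m w,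
      Function.iterate_succ_apply (act S fun i j => G j i) m v, ← ih]
    simp only [act, Finset.mul_sum, Finset.sum_mul]
    rw [Finset.sum_comm]
    exact Finset.sum_congr rfl fun i _ => Finset.sum_congr rfl fun j _ => by ring

/-- Reversing the closed walks at `o` preserves their lengths and weights. -/
theorem sol_transpose (S : Finset ι) (G : ι → ι → ℝ≥0∞) (o : ι) :
    sol S (fun i j => G j i) o o = sol S G o o := by
  refine tsum_congr fun m => ?_
  cases m with
  | zero => rfl
  | succ m =>
    rw [Function.iterate_succ_apply', Function.iterate_succ_apply', act, act,
      sum_mul_act_iterate S G m]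
    exact Finset.sum_congr rfl fun j _ => mul_comm _ _

/-- An infinite solution at an index that is reached from `o` makes the solution at `o` infinite. -/
theorem sol_eq_top {S : Finset ι} {G : ι → ι → ℝ≥0∞} {o k : ι} (hk : k ∈ S)
    (hacc : sol S (fun i j => G j i) o k ≠ 0) (htop : sol S G o k = ∞) : sol S G o o = ∞ := by
  classical
  by_contra ho
  -- An index with a finite solution has no edge to one with an infinite solution. So, if the
  -- solution at `o` were finite, the vector that is 0 on the infinite indices in `S` and ∞
  -- elsewhere would be a supersolution of the transposed system, contrary to `hacc`.
  have key : ∀ i j, j ∈ S → sol S G o j = ∞ → sol S G o i ≠ ∞ → G i j = 0 := by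
    intro i j hj hjt hit
    by_contra h0
    have := mul_le_sol hj G o i
    rw [hjt, ENNReal.mul_top h0, top_le_iff] at this
    exact hit this
  refine hacc (le_antisymm ((sol_le (y := fun j => if j ∈ S ∧ sol S G o j = ∞ then 0 else ∞)
    (fun j => ?_) k).trans (by simp [hk, htop])) zero_le)
  by_cases hj : j ∈ S ∧ sol S G o j = ∞
  · rw [if_pos hj, key o j hj.1 hj.2 ho, add_zero]
    refine (Finset.sum_eq_zero fun i hi => ?_).le
    by_cases hit : sol S G o i = ∞
    · rw [if_pos ⟨hi, hit⟩, mul_zero]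
    · rw [key i j hj.1 hj.2 hit, zero_mul]
  · rw [if_neg hj]
    exact le_top

/-! #### Elimination -/

/-- Elimination of the index `k`, where `(1 - a)⁻¹ = ∑ n, a ^ n`. -/
noncomputable def elim (k : ι) (G : ι → ι → ℝ≥0∞) (i j : ι) : ℝ≥0∞ :=
  G i j + G i k * (1 - G k k)⁻¹ * G k j

/-- With truncated subtraction the geometric series equals (1 - a)⁻¹ for every a, and both are ∞
when a ≥ 1; no case distinction is needed. -/
theorem inv_one_sub_eq (a : ℝ≥0∞) : (1 - a)⁻¹ = 1 + a * (1 - a)⁻¹ := by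
  rw [← ENNReal.tsum_geometric, ← ENNReal.tsum_mul_left]
  simp only [← pow_succ']
  rw [tsum_eq_zero_add' ENNReal.summable, pow_zero]

theorem inv_one_sub_mul_le {a r x : ℝ≥0∞} (h : a * x + r ≤ x) : (1 - a)⁻¹ * r ≤ x := by
  rw [← ENNReal.tsum_geometric, ← ENNReal.tsum_mul_right]
  refine ENNReal.tsum_le_of_sum_range_le fun m => ?_
  induction m with
  | zero => simp
  | succ m ih =>
    rw [Finset.sum_range_succ', pow_zero, one_mul]
    refine le_trans (add_le_add ?_ le_rfl) h
    simp only [pow_succ', mul_assoc]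
    rw [← Finset.mul_sum]
    exact mul_le_mul_right ih _

theorem sum_elim (S : Finset ι) (G : ι → ι → ℝ≥0∞) (k o i : ι) (y : ι → ℝ≥0∞) :
    ∑ j ∈ S, elim k G i j * y j + elim k G i o =
      (∑ j ∈ S, G i j * y j + G i o) +
        G i k * ((1 - G k k)⁻¹ * (∑ j ∈ S, G k j * y j + G k o)) := by
  simp only [elim, add_mul, Finset.sum_add_distrib, mul_add, Finset.mul_sum, mul_assoc]
  ring

theorem sol_elim_self (S : Finset ι) (G : ι → ι → ℝ≥0∞) (k o : ι) :
    sol S (elim k G) o k =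
      (1 - G k k)⁻¹ * (∑ j ∈ S, G k j * sol S (elim k G) o j + G k o) := by
  rw [sol_eq, sum_elim]
  conv_rhs => rw [inv_one_sub_eq, add_mul, one_mul, mul_assoc]

/-- Solving the equation of `k` for its own unknown and substituting shows that each of the two
least solutions is a supersolution of the other system. Leastness for the scalar equation is
`inv_one_sub_mul_le`. -/
theorem sol_insert [DecidableEq ι] {S : Finset ι} {k : ι} (hk : k ∉ S) (G : ι → ι → ℝ≥0∞) (o : ι) :
    sol (insert k S) G o = sol S (elim k G) o := by
  refine funext fun i => le_antisymm (sol_le (fun i => ?_) i) (sol_le (fun i => ?_) i)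
  · rw [Finset.sum_insert hk, sol_elim_self, sol_eq S (elim k G) o i, sum_elim, add_assoc, add_comm]
  · rw [sum_elim]
    rw [sol_eq (insert k S) G o i, Finset.sum_insert hk]
    refine le_trans (add_le_add le_rfl (mul_le_mul_right (inv_one_sub_mul_le ?_) _))
      (b := _ + G i k * sol (insert k S) G o k) (le_of_eq (by ring))
    have h := sol_eq (insert k S) G o k
    rw [Finset.sum_insert hk, add_assoc] at h
    exact h.ge

theorem sol_eq_top_of_one_le [DecidableEq ι] {S : Finset ι} {k : ι} (hk : k ∉ S)
    {G : ι → ι → ℝ≥0∞} {o : ι} (h1 : 1 ≤ G k k) (h0 : sol (insert k S) G o k ≠ 0) :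
    sol (insert k S) G o k = ∞ := by
  rw [sol_insert hk, sol_elim_self, tsub_eq_zero_of_le h1, ENNReal.inv_zero] at h0 ⊢
  exact ENNReal.top_mul (right_ne_zero_of_mul h0)

/-- Elimination of the indices below `k`. -/
noncomputable def elims (G : ℕ → ℕ → ℝ≥0∞) : ℕ → ℕ → ℕ → ℝ≥0∞
  | 0 => G
  | k + 1 => elim k (elims G k)

theorem sol_elims (G : ℕ → ℕ → ℝ≥0∞) {k n : ℕ} (h : k ≤ n) (o : ℕ) :
    sol (Finset.Ico k n) (elims G k) o = sol (Finset.range n) G o := by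
  induction k with
  | zero => rw [Finset.range_eq_Ico, elims]
  | succ k ih =>
    rw [← ih (by omega), ← Finset.insert_Ico_add_one_left_eq_Ico (show k < n by omega),
      sol_insert (by simp)]
    rfl

theorem elims_eq_sol (G : ℕ → ℕ → ℝ≥0∞) (n i o : ℕ) :
    elims G n i o = sol (Finset.range n) G o i := by
  rw [← sol_elims G le_rfl, Finset.Ico_self, sol_empty]

theorem elims_zero_row {G : ℕ → ℕ → ℝ≥0∞} {i : ℕ} (h : ∀ j, G i j = 0) (k j : ℕ) :
    elims G k i j = 0 := by
  induction k generalizing j with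
  | zero => exact h j
  | succ k ih => rw [elims, elim, ih, ih, zero_mul, zero_mul, zero_add]

theorem elims_zero_column {G : ℕ → ℕ → ℝ≥0∞} {j : ℕ} (h : ∀ i, G i j = 0) (k i : ℕ) :
    elims G k i j = 0 := by
  induction k generalizing i with
  | zero => exact h i
  | succ k ih => rw [elims, elim, ih, ih, mul_zero, zero_add]

theorem elims_transpose (G : ℕ → ℕ → ℝ≥0∞) (k i j : ℕ) :
    elims (fun i j => G j i) k i j = elims G k j i := by
  induction k generalizing i j with
  | zero => rfl
  | succ k ih =>
    simp only [elims, elim, ih]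
    ring

/-- The factor (1 - a)⁻¹ never vanishes, so zero patterns evolve as in Warshall's algorithm,
independently of the weights. -/
theorem elim_eq_zero (k i j : ι) (G : ι → ι → ℝ≥0∞) :
    elim k G i j = 0 ↔ G i j = 0 ∧ (G i k = 0 ∨ G k j = 0) := by
  have h : (1 - G k k)⁻¹ ≠ 0 := ENNReal.inv_ne_zero.2 (ENNReal.sub_ne_top (by simp))
  simp [elim, h]

end LinearSystem

end PGA

namespace PGA

/-! ### Fraction-free elimination -/

namespace Bareiss

/-- Gaussian elimination of the indices below `k`. -/
def schur {K : Type*} [Field K] (A : ℕ → ℕ → K) : ℕ → ℕ → ℕ → K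
  | 0 => A
  | k + 1 => fun i j => schur A k i j - schur A k i k * schur A k k j / schur A k k k

def minorIndex (k i : ℕ) (a : Fin (k + 1)) : ℕ := if (a : ℕ) < k then a else i

/-- The minor with the rows `0, …, k - 1, i` and the columns `0, …, k - 1, j`. -/
def minor {R : Type*} [CommRing R] (A : ℕ → ℕ → R) (k i j : ℕ) : R :=
  (Matrix.of fun a b => A (minorIndex k i a) (minorIndex k j b)).det

/-- Clear the first column by multiples of the first row, then expand along it. -/
theorem det_eq_mul_det_sub {K : Type*} [Field K] {n : ℕ} (X : Matrix (Fin (n + 1)) (Fin (n + 1)) K)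
    (h : X 0 0 ≠ 0) : X.det = X 0 0 * (Matrix.of fun a b : Fin n =>
      X a.succ b.succ - X a.succ 0 * X 0 b.succ / X 0 0).det := by
  let Y : Matrix (Fin (n + 1)) (Fin (n + 1)) K :=
    Matrix.of fun a b => if a = 0 then X 0 b else X a b - X a 0 / X 0 0 * X 0 b
  have hY : X.det = Y.det := by
    refine Matrix.det_eq_of_forall_row_eq_smul_add_const
      (fun a => if a = 0 then 0 else X a 0 / X 0 0) 0 (if_pos rfl) fun i j => ?_
    by_cases hi : i = 0 <;> simp [Y, hi]
  rw [hY, Matrix.det_succ_column_zero, Fin.sum_univ_succ, Finset.sum_eq_zero, add_zero]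
  · simp only [Fin.val_zero, pow_zero, one_mul]
    congr 1
    congr 1
    ext a b
    simp [Y, Fin.succ_ne_zero]
    ring
  · intro i _
    simp [Y, Fin.succ_ne_zero, h]

theorem schur_succ_succ {K : Type*} [Field K] (A : ℕ → ℕ → K) (k i j : ℕ) :
    schur A (k + 1) (i + 1) (j + 1) = schur (fun i j => schur A 1 (i + 1) (j + 1)) k i j := by
  induction k generalizing i j with
  | zero => rfl
  | succ k ih =>
    rw [schur]
    simp only [ih]
    rfl

/-- The induction peels off the index 0, not the last one: one Schur complement turns the minor into
a smaller minor of `schur A 1`, whose elimination is that of `A` shifted by one (`schur_succ_succ`).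
-/
theorem minor_eq {K : Type*} [Field K] {A : ℕ → ℕ → K} {k i j : ℕ}
    (h : ∀ l < k, schur A l l l ≠ 0) (hi : k ≤ i) (hj : k ≤ j) :
    minor A k i j = (∏ l ∈ Finset.range k, schur A l l l) * schur A k i j := by
  induction k generalizing A i j with
  | zero => simp [minor, minorIndex, schur]
  | succ k ih =>
    obtain ⟨i, rfl⟩ := Nat.exists_eq_add_of_le' (show 1 ≤ i by omega)
    obtain ⟨j, rfl⟩ := Nat.exists_eq_add_of_le' (show 1 ≤ j by omega)
    have h0 : A 0 0 ≠ 0 := h 0 (by omega)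
    have hs : ∀ i (a : Fin (k + 1)), minorIndex (k + 1) (i + 1) a.succ = minorIndex k i a + 1 := by
      intro i a
      simp only [minorIndex, Fin.val_succ, Nat.add_lt_add_iff_right]
      split <;> rfl
    have hz : ∀ i, minorIndex (k + 1) i 0 = 0 := by simp [minorIndex]
    rw [minor, det_eq_mul_det_sub _ (by simpa [hz] using h0)]
    simp only [Matrix.of_apply, hs, hz]
    have := ih (A := fun i j => schur A 1 (i + 1) (j + 1)) (i := i) (j := j) (fun l hl => by
      rw [← schur_succ_succ]
      exact h (l + 1) (by omega)) (by omega) (by omega)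
    rw [minor] at this
    simp only [← schur_succ_succ] at this
    rw [Finset.prod_range_succ', mul_right_comm, ← this, mul_comm]
    rfl

/-- Leibniz formula: the first summand of the exponent pays for the factorial, the second for a
product of at most n + 1 entries. -/
theorem abs_minor_le {A : ℕ → ℕ → ℤ} {n c : ℕ} (hA : ∀ i ≤ n, ∀ j ≤ n, |A i j| ≤ 2 ^ c) {k i j : ℕ}
    (hk : k ≤ n) (hi : i ≤ n) (hj : j ≤ n) :
    |minor A k i j| ≤ 2 ^ ((n + 1) * (n + 1) + c * (n + 1)) := by
  have hm : ∀ i ≤ n, ∀ a : Fin (k + 1), minorIndex k i a ≤ n := by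
    intro i hi a
    rw [minorIndex]
    split <;> omega
  have := Matrix.det_le (A := Matrix.of fun a b => A (minorIndex k i a) (minorIndex k j b))
    (abv := AbsoluteValue.abs) (x := 2 ^ c) fun a b => hA _ (hm i hi a) _ (hm j hj b)
  refine le_trans this ?_
  rw [Fintype.card_fin, nsmul_eq_mul, pow_add 2, pow_mul 2 c]
  refine mul_le_mul ?_ (pow_le_pow_right₀ (one_le_pow₀ (by norm_num)) (by omega)) (by positivity)
    (by positivity)
  have h1 : (k + 1).factorial ≤ (n + 1) ^ (n + 1) :=
    (Nat.factorial_le (by omega)).trans (Nat.factorial_le_pow _)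
  have h2 : (n + 1) ^ (n + 1) ≤ 2 ^ ((n + 1) * (n + 1)) := by
    rw [pow_mul]
    exact Nat.pow_le_pow_left Nat.lt_two_pow_self.le _
  exact_mod_cast h1.trans h2

/-! ### The Bareiss recurrence for the system `N / D` -/

/-- The matrix `D - N`. -/
def diagSub (D : ℕ) (N : ℕ → ℕ → ℕ) (i j : ℕ) : ℤ := (if i = j then (D : ℤ) else 0) - N i j

/-- The matrix `N / D`. -/
noncomputable def scaled (D : ℕ) (N : ℕ → ℕ → ℕ) (i j : ℕ) : ℝ≥0∞ := (N i j : ℝ≥0∞) / D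

/-- After the elimination of the indices below `k` from the matrix `N / D` with the indices
`0, …, n`, the matrix is `B / (p * D)`. -/
structure Invariant (D n : ℕ) (N : ℕ → ℕ → ℕ) (k p : ℕ) (B : ℕ → ℕ → ℕ) : Prop where
  pos : 0 < p
  pivot : ∀ l < k, schur (fun i j => (diagSub D N i j : ℚ)) l l l ≠ 0
  prod : (p : ℚ) = ∏ l ∈ Finset.range k, schur (fun i j => (diagSub D N i j : ℚ)) l l l
  entry : ∀ i j, k ≤ i → i ≤ n → k ≤ j → j ≤ n → (B i j : ℚ) =
    p * ((if i = j then (D : ℚ) else 0) - schur (fun i j => (diagSub D N i j : ℚ)) k i j)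
  elims : ∀ i j, k ≤ i → i ≤ n → k ≤ j → j ≤ n →
    LinearSystem.elims (scaled D N) k i j = (B i j : ℝ≥0∞) / ((p * D : ℕ) : ℝ≥0∞)

theorem Invariant.zero (D n : ℕ) (N : ℕ → ℕ → ℕ) : Invariant D n N 0 1 N where
  pos := one_pos
  pivot _ h := absurd h (Nat.not_lt_zero _)
  prod := by simp
  entry i j _ _ _ _ := by simp [schur, diagSub]
  elims i j _ _ _ _ := by simp [LinearSystem.elims, scaled]

variable {D n k p : ℕ} {N B : ℕ → ℕ → ℕ}

theorem minor_cast (A : ℕ → ℕ → ℤ) (k i j : ℕ) :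
    ((minor A k i j : ℤ) : ℚ) = minor (fun i j => (A i j : ℚ)) k i j := by
  rw [minor, minor, Int.cast_det]
  rfl

theorem Invariant.entry_eq (h : Invariant D n N k p B) {i j : ℕ} (hi : k ≤ i) (hi' : i ≤ n)
    (hj : k ≤ j) (hj' : j ≤ n) :
    (B i j : ℤ) = p * (if i = j then (D : ℤ) else 0) - minor (diagSub D N) k i j := by
  have : (B i j : ℚ) =
        ((p * (if i = j then (D : ℤ) else 0) - minor (diagSub D N) k i j : ℤ) : ℚ) := by
    push_cast
    rw [minor_cast, minor_eq h.pivot hi hj, h.entry i j hi hi' hj hj', h.prod, mul_sub]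
  exact_mod_cast this

/-- Since `a < D * p`, the inverse is that of a positive real, and the claim is a field identity;
the common factor `p` cancels by divisibility. -/
theorem elim_div {a b c d p D : ℕ} (hp : 0 < p) (hD : 0 < D) (ha : a < D * p)
    (hdvd : p ∣ (D * p - a) * d + b * c) :
    (d : ℝ≥0∞) / ((p * D : ℕ) : ℝ≥0∞) + (b : ℝ≥0∞) / ((p * D : ℕ) : ℝ≥0∞) *
      (1 - (a : ℝ≥0∞) / ((p * D : ℕ) : ℝ≥0∞))⁻¹ * ((c : ℝ≥0∞) / ((p * D : ℕ) : ℝ≥0∞)) =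
    ((((D * p - a) * d + b * c) / p : ℕ) : ℝ≥0∞) / (((D * p - a) * D : ℕ) : ℝ≥0∞) := by
  obtain ⟨e, he⟩ := hdvd
  rw [he, Nat.mul_div_cancel_left _ hp]
  obtain ⟨q, hq⟩ := Nat.exists_eq_add_of_lt ha
  have hq' : D * p - a = q + 1 := by omega
  rw [hq'] at he ⊢
  have hpD : p * D = a + (q + 1) := by rw [mul_comm, hq]; ring
  have hpD0 : ((p * D : ℕ) : ℝ≥0) ≠ 0 := by exact_mod_cast (Nat.mul_pos hp hD).ne'
  have hsub : (1 : ℝ≥0∞) - (a : ℝ≥0∞) / ((p * D : ℕ) : ℝ≥0∞) =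
      (((q + 1 : ℕ) : ℝ≥0) / ((p * D : ℕ) : ℝ≥0) : ℝ≥0) := by
    rw [ENNReal.sub_eq_of_eq_add]
    · exact ENNReal.div_ne_top (by simp) (by exact_mod_cast (Nat.mul_pos hp hD).ne')
    · rw [← ENNReal.coe_natCast a, ← ENNReal.coe_natCast (p * D), ← ENNReal.coe_div hpD0,
        ← ENNReal.coe_add, ← add_div, ← ENNReal.coe_one]
      congr 1
      rw [eq_comm, div_eq_one_iff_eq hpD0, hpD]
      push_cast
      ring
  have hq0 : (((q + 1 : ℕ) : ℝ≥0) / ((p * D : ℕ) : ℝ≥0)) ≠ 0 :=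
    div_ne_zero (by positivity) hpD0
  have hqD : (((q + 1) * D : ℕ) : ℝ≥0) ≠ 0 := by positivity
  rw [hsub, ← ENNReal.coe_inv hq0]
  simp only [← ENNReal.coe_natCast]
  rw [← ENNReal.coe_div hpD0, ← ENNReal.coe_div hpD0, ← ENNReal.coe_div hpD0,
    ← ENNReal.coe_div hqD]
  rw [← ENNReal.coe_mul, ← ENNReal.coe_mul, ← ENNReal.coe_add, ENNReal.coe_inj]
  have he' : ((q : ℝ≥0) + 1) * d + b * c = p * e := by exact_mod_cast he
  have hp0 : (p : ℝ≥0) ≠ 0 := by positivity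
  have hD0 : (D : ℝ≥0) ≠ 0 := by positivity
  push_cast
  field_simp
  rw [← he', mul_comm (d : ℝ≥0)]

theorem schur_diag (h : Invariant D n N k p B) (hk : k < n) :
    (p : ℚ) * schur (fun i j => (diagSub D N i j : ℚ)) k k k = D * p - B k k := by
  rw [h.entry k k le_rfl hk.le le_rfl hk.le, if_pos rfl]
  ring

/-- One step of the fraction-free elimination. -/
theorem Invariant.succ (h : Invariant D n N k p B) (hD : 0 < D) (hk : k < n) (hlt : B k k < D * p)
    {B' : ℕ → ℕ → ℕ} (hB' : ∀ i j, k < i → i ≤ n → k < j → j ≤ n →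
      B' i j = ((D * p - B k k) * B i j + B i k * B k j) / p) :
    Invariant D n N (k + 1) (D * p - B k k) B' := by
  have hp0 : (p : ℚ) ≠ 0 := by exact_mod_cast h.pos.ne'
  have hdiag := schur_diag h hk
  have hp' : ((D * p - B k k : ℕ) : ℚ) =
      p * schur (fun i j => (diagSub D N i j : ℚ)) k k k := by
    rw [hdiag, Nat.cast_sub hlt.le, Nat.cast_mul]
  have hpos : 0 < D * p - B k k := by omega
  have hs0 : schur (fun i j => (diagSub D N i j : ℚ)) k k k ≠ 0 := by
    intro h0
    rw [h0, mul_zero] at hp'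
    exact hpos.ne' (by exact_mod_cast hp')
  have hpivot : ∀ l < k + 1, schur (fun i j => (diagSub D N i j : ℚ)) l l l ≠ 0 := by
    intro l hl
    rcases Nat.lt_succ_iff_lt_or_eq.1 hl with hl | rfl
    · exact h.pivot l hl
    · exact hs0
  have hprod : ((D * p - B k k : ℕ) : ℚ) =
      ∏ l ∈ Finset.range (k + 1), schur (fun i j => (diagSub D N i j : ℚ)) l l l := by
    rw [Finset.prod_range_succ, ← h.prod, hp']
  have hX : ∀ i j, k < i → i ≤ n → k < j → j ≤ n →
      (((D * p - B k k) * B i j + B i k * B k j : ℕ) : ℚ) = p * (((D * p - B k k : ℕ) : ℚ) *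
        ((if i = j then (D : ℚ) else 0) -
          schur (fun i j => (diagSub D N i j : ℚ)) (k + 1) i j)) := by
    intro i j hi hi' hj hj'
    rw [Nat.cast_add, Nat.cast_mul, Nat.cast_mul, h.entry i j hi.le hi' hj.le hj',
      h.entry i k hi.le hi' le_rfl hk.le, h.entry k j le_rfl hk.le hj.le hj', if_neg hi.ne',
      if_neg hj.ne, hp', schur]
    field_simp
    ring
  -- The quotient is a diagonal term minus a minor of `D - N` of the next order, hence an integer.
  have hdvd : ∀ i j, k < i → i ≤ n → k < j → j ≤ n →
      p ∣ (D * p - B k k) * B i j + B i k * B k j := by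
    intro i j hi hi' hj hj'
    have hm := minor_eq hpivot hi hj
    rw [← minor_cast, ← hprod] at hm
    have := hX i j hi hi' hj hj'
    rw [mul_sub, ← hm] at this
    refine Int.natCast_dvd_natCast.1 ⟨((D * p - B k k : ℕ) : ℤ) * (if i = j then (D : ℤ) else 0) -
      minor (diagSub D N) (k + 1) i j, ?_⟩
    have h' : ((((D * p - B k k) * B i j + B i k * B k j : ℕ) : ℤ) : ℚ) =
      (((p : ℤ) * (((D * p - B k k : ℕ) : ℤ) * (if i = j then (D : ℤ) else 0) -
        minor (diagSub D N) (k + 1) i j) : ℤ) : ℚ) := by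
      rw [Int.cast_natCast, this]
      push_cast
      rfl
    exact_mod_cast h'
  refine ⟨hpos, hpivot, hprod, fun i j hi hi' hj hj' => ?_, fun i j hi hi' hj hj' => ?_⟩
  · rw [hB' i j hi hi' hj hj', Nat.cast_div (hdvd i j hi hi' hj hj') hp0, hX i j hi hi' hj hj',
      mul_div_cancel_left₀ _ hp0]
  · rw [hB' i j hi hi' hj hj', LinearSystem.elims, LinearSystem.elim,
      h.elims i j (by omega) hi' (by omega) hj', h.elims i k (by omega) hi' le_rfl hk.le,
      h.elims k k le_rfl hk.le le_rfl hk.le, h.elims k j le_rfl hk.le (by omega) hj']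
    exact elim_div h.pos hD hlt (hdvd i j hi hi' hj hj')

theorem Invariant.one_le_elims (h : Invariant D n N k p B) (hD : 0 < D) (hk : k < n)
    (hle : D * p ≤ B k k) : 1 ≤ LinearSystem.elims (scaled D N) k k k := by
  rw [h.elims k k le_rfl hk.le le_rfl hk.le, ENNReal.le_div_iff_mul_le
    (Or.inl (by exact_mod_cast (Nat.mul_pos h.pos hD).ne'))
    (Or.inl (ENNReal.natCast_ne_top _)), one_mul, mul_comm p]
  exact_mod_cast hle

variable {c : ℕ}

theorem abs_diagSub_le (hD : D < 2 ^ c) (hN : ∀ i ≤ n, ∀ j ≤ n, N i j < 2 ^ c) :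
    ∀ i ≤ n, ∀ j ≤ n, |diagSub D N i j| ≤ 2 ^ c := by
  intro i hi j hj
  have h1 : (D : ℤ) < 2 ^ c := by exact_mod_cast hD
  have h2 : (N i j : ℤ) < 2 ^ c := by exact_mod_cast hN i hi j hj
  rw [diagSub, abs_le]
  split <;> omega

/-- The scaling factor is a product of pivots, that is, a leading principal minor (or 1 at the
start). -/
theorem Invariant.pivot_le (h : Invariant D n N k p B) (hk : k ≤ n) (hD : D < 2 ^ c)
    (hN : ∀ i ≤ n, ∀ j ≤ n, N i j < 2 ^ c) : p ≤ 2 ^ ((n + 1) * (n + 1) + c * (n + 1)) := by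
  have hprod := h.prod
  cases k with
  | zero =>
    have : p = 1 := by simpa using hprod
    rw [this]
    exact Nat.one_le_two_pow
  | succ l =>
    have hm := minor_eq (fun m hm => h.pivot m (by omega)) (le_refl l) (le_refl l)
    rw [Finset.prod_range_succ, ← hm, ← minor_cast] at hprod
    have h' : (p : ℤ) = minor (diagSub D N) l l l := by exact_mod_cast hprod
    have := (le_abs_self _).trans (abs_minor_le (abs_diagSub_le hD hN) (show l ≤ n by omega)
      (show l ≤ n by omega) (show l ≤ n by omega))
    rw [← h'] at this
    exact_mod_cast this

theorem Invariant.entry_le (h : Invariant D n N k p B) (hk : k ≤ n) (hD : D < 2 ^ c)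
    (hN : ∀ i ≤ n, ∀ j ≤ n, N i j < 2 ^ c) {i j : ℕ} (hi : k ≤ i) (hi' : i ≤ n)
    (hj : k ≤ j) (hj' : j ≤ n) : B i j ≤ 2 ^ ((n + 1) * (n + 1) + c * (n + 1) + c + 1) := by
  have h1 := h.entry_eq hi hi' hj hj'
  have h2 := (neg_le_abs _).trans (abs_minor_le (abs_diagSub_le hD hN) hk hi' hj')
  have h3 := h.pivot_le hk hD hN
  set b := (n + 1) * (n + 1) + c * (n + 1)
  have h4 : p * D ≤ 2 ^ b * 2 ^ c := Nat.mul_le_mul h3 hD.le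
  have h5 : 2 ^ b ≤ 2 ^ b * 2 ^ c := Nat.le_mul_of_pos_right _ (by positivity)
  rw [pow_succ, pow_add]
  zify at h4 h5 ⊢
  split at h1 <;> nlinarith

end Bareiss

end PGA

namespace PGA

/-! ### The algorithm -/

namespace Algorithm

open LinearSystem Bareiss

/-- An entry of a matrix that is given by its rows. -/
def entry (M : List (List ℕ)) (i j : ℕ) : ℕ := (M.getD i []).getD j 0

/-- The matrix with the entries `f i j` for `i, j ≤ n`. -/
def table (n : ℕ) (f : ℕ → ℕ → ℕ) : List (List ℕ) :=
  (List.range (n + 1)).map fun i => (List.range (n + 1)).map fun j => f i j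

theorem entry_table_eq_ite (n : ℕ) (f : ℕ → ℕ → ℕ) (i j : ℕ) :
    entry (table n f) i j = if i ≤ n ∧ j ≤ n then f i j else 0 := by
  by_cases hi : i ≤ n
  · by_cases hj : j ≤ n
    · simp [entry, table, hi, hj, List.getD_eq_getElem?_getD]
    · simp [entry, table, hi, hj, List.getD_eq_getElem?_getD]
  · simp [entry, table, hi, List.getD_eq_getElem?_getD]

theorem entry_table {n : ℕ} (f : ℕ → ℕ → ℕ) {i j : ℕ} (hi : i ≤ n) (hj : j ≤ n) :
    entry (table n f) i j = f i j := by
  rw [entry_table_eq_ite, if_pos ⟨hi, hj⟩]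

/-- One step of the computation of the transitive closure. -/
def closureStep (n : ℕ) (W : List (List ℕ)) (k : ℕ) : List (List ℕ) :=
  table n fun i j => if entry W i j = 0 ∧ (entry W i k = 0 ∨ entry W k j = 0) then 0 else 1

/-- The transitive closure of a matrix. -/
def closure (n : ℕ) (N : List (List ℕ)) : List (List ℕ) := (List.range n).foldl (closureStep n) N

/-- Remove the rows of the indices from which `n` is not reached, and transpose. -/
def trim (n : ℕ) (N : List (List ℕ)) : List (List ℕ) :=
  table n fun i j => if entry (closure n N) j n = 0 then 0 else entry N j i

/-- One step of the fraction-free elimination. The state consists of a flag, which is cleared if a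
pivot is at least one, the scaling factor and the matrix. -/
def pivotStep (n D : ℕ) (s : Bool × ℕ × List (List ℕ)) (k : ℕ) : Bool × ℕ × List (List ℕ) :=
  if s.1 then
    if D * s.2.1 ≤ entry s.2.2 k k then (false, s.2.1, s.2.2)
    else (true, D * s.2.1 - entry s.2.2 k k, table n fun i j =>
      if k < i ∧ k < j then
        ((D * s.2.1 - entry s.2.2 k k) * entry s.2.2 i j +
          entry s.2.2 i k * entry s.2.2 k j) / s.2.1
      else 0)
  else s

/-- The fraction-free elimination of the indices below `n`. -/
def eliminate (n D : ℕ) (N : List (List ℕ)) : Bool × ℕ × List (List ℕ) :=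
  (List.range n).foldl (pivotStep n D) (true, 1, N)

/-- The solution of the system `N / D` at the index `n`: numerator and denominator, where `1 / 0`
stands for `∞`. -/
def solve (n D : ℕ) (N : List (List ℕ)) : ℕ × ℕ :=
  let s := eliminate n D (trim n (trim n N))
  if s.1 then (entry s.2.2 n n, s.2.1 * D) else (1, 0)

/-! ### Correctness of the algorithm -/

variable {n D : ℕ}

theorem scaled_eq_zero {N : ℕ → ℕ → ℕ} {i j : ℕ} : scaled D N i j = 0 ↔ N i j = 0 := by
  simp [scaled, ENNReal.div_eq_zero_iff]

theorem foldl_closureStep (N : List (List ℕ)) {k : ℕ} (hk : k ≤ n) {i j : ℕ} (hi : i ≤ n)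
    (hj : j ≤ n) : entry ((List.range k).foldl (closureStep n) N) i j = 0 ↔
      elims (scaled D (entry N)) k i j = 0 := by
  induction k generalizing i j with
  | zero => exact scaled_eq_zero.symm
  | succ k ih =>
    have hk' : k ≤ n := by omega
    rw [List.range_succ, List.foldl_append, List.foldl_cons, List.foldl_nil, closureStep,
      entry_table _ hi hj, elims, elim_eq_zero, ← ih hk' hi hj, ← ih hk' hi hk', ← ih hk' hk' hj]
    split <;> simp_all

theorem entry_closure_eq_zero (N : List (List ℕ)) {i : ℕ} (hi : i ≤ n) :
    entry (closure n N) i n = 0 ↔ sol (Finset.range n) (scaled D (entry N)) n i = 0 := by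
  rw [closure, foldl_closureStep N le_rfl hi le_rfl, elims_eq_sol]

theorem entry_trim {f : ℕ → ℕ → ℕ} (D i j : ℕ) : entry (trim n (table n f)) i j =
    if sol (Finset.range n) (scaled D (entry (table n f))) n j = 0 then 0
      else entry (table n f) j i := by
  rw [trim, entry_table_eq_ite]
  by_cases h : i ≤ n ∧ j ≤ n
  · rw [if_pos h]
    simp only [entry_closure_eq_zero (D := D) _ h.2]
  · have h0 : entry (table n f) j i = 0 := by
      rw [entry_table_eq_ite, if_neg fun h' => h ⟨h'.2, h'.1⟩]
    rw [if_neg h, h0, ite_self]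

/-- Transposed back, the trimmed matrix differs only in rows whose solution vanishes. -/
theorem sol_trim (D : ℕ) (f : ℕ → ℕ → ℕ) :
    sol (Finset.range n) (fun i j => scaled D (entry (trim n (table n f))) j i) n =
      sol (Finset.range n) (scaled D (entry (table n f))) n := by
  refine sol_zero_rows _ _ _ (fun i hi j => ?_) fun i hi j => ?_
  · rw [scaled, entry_trim D, if_pos hi, Nat.cast_zero, ENNReal.zero_div]
  · rw [scaled, entry_trim D, if_neg hi, scaled]

theorem sol_trim_self (D : ℕ) (f : ℕ → ℕ → ℕ) :
    sol (Finset.range n) (scaled D (entry (trim n (table n f)))) n n =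
      sol (Finset.range n) (scaled D (entry (table n f))) n n := by
  rw [← sol_trim D f, ← sol_transpose]

/-- A pivot that is at least 1 cannot stem from a zero row or column, so `k` survived both
trimmings: it reaches n and is reached from n. The first makes the solution at `k`, in one
orientation, nonzero and hence ∞; the second carries ∞ to the index n. -/
theorem sol_eq_top_of_pivot (D : ℕ) (f : ℕ → ℕ → ℕ) {k : ℕ} (hk : k < n)
    (h : 1 ≤ elims (scaled D (entry (trim n (trim n (table n f))))) k k k) :
    sol (Finset.range n) (scaled D (entry (table n f))) n n = ∞ := by
  set N₁ := trim n (table n f) with hN₁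
  obtain ⟨g, hg⟩ : ∃ g, N₁ = table n g := ⟨_, rfl⟩
  have hrow : ∃ i, entry (trim n N₁) i k ≠ 0 := by
    by_contra! h0
    rw [elims_zero_column fun i => scaled_eq_zero.2 (h0 i)] at h
    simp at h
  have hcol : ∃ j, entry (trim n N₁) k j ≠ 0 := by
    by_contra! h0
    rw [elims_zero_row fun j => scaled_eq_zero.2 (h0 j)] at h
    simp at h
  obtain ⟨i, hi⟩ := hrow
  obtain ⟨j, hj⟩ := hcol
  rw [hg, entry_trim D] at hi hj
  have hi₁ : sol (Finset.range n) (scaled D (entry N₁)) n k ≠ 0 := by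
    intro h0
    rw [← hg, if_pos h0] at hi
    exact hi rfl
  have hj₁ : entry N₁ j k ≠ 0 := by
    intro h0
    rw [← hg, h0, ite_self] at hj
    exact hj rfl
  have hacc : sol (Finset.range n) (fun i j => scaled D (entry N₁) j i) n k ≠ 0 := by
    rw [hN₁, sol_trim]
    intro h0
    rw [hN₁, entry_trim D, if_pos h0] at hj₁
    exact hj₁ rfl
  rw [← sol_trim_self, ← hN₁]
  refine sol_eq_top (Finset.mem_range.2 hk) hacc ?_
  have hsol := sol_trim (n := n) D g
  rw [← hg] at hsol
  rw [← hsol] at hi₁ ⊢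
  rw [← sol_elims _ hk.le, ← Finset.insert_Ico_add_one_left_eq_Ico hk] at hi₁ ⊢
  refine sol_eq_top_of_one_le (by simp) ?_ hi₁
  rwa [elims_transpose]

theorem eliminate_spec (hD : 0 < D) (N : List (List ℕ)) {k : ℕ} (hk : k ≤ n) :
    let s := (List.range k).foldl (pivotStep n D) (true, 1, N)
    (s.1 = true → Invariant D n (entry N) k s.2.1 (entry s.2.2)) ∧
    (s.1 = false → ∃ l < n, 1 ≤ elims (scaled D (entry N)) l l l) := by
  induction k with
  | zero => exact ⟨fun _ => .zero _ _ _, fun h => absurd h (by simp)⟩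
  | succ k ih =>
    have ih := ih (by omega)
    rw [List.range_succ, List.foldl_append, List.foldl_cons, List.foldl_nil]
    generalize (List.range k).foldl (pivotStep n D) (true, 1, N) = s at ih
    obtain ⟨b, p, B⟩ := s
    obtain ⟨h1, h2⟩ := ih
    cases b with
    | false => exact ⟨fun h => absurd h (by simp [pivotStep]), fun _ => h2 rfl⟩
    | true =>
      have h1 := h1 rfl
      by_cases hle : D * p ≤ entry B k k
      · simp only [pivotStep, if_true, if_pos hle]
        exact ⟨fun h => absurd h (by simp), fun _ =>
          ⟨k, by omega, h1.one_le_elims hD (by omega) hle⟩⟩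
      · simp only [pivotStep, if_true, if_neg hle]
        refine ⟨fun _ => h1.succ hD (by omega) (not_le.1 hle) fun i j hi hi' hj hj' => ?_,
          fun h => absurd h (by simp)⟩
        rw [entry_table _ hi' hj', if_pos ⟨hi, hj⟩]

/-- The number that is presented by numerator and denominator. -/
noncomputable def value (q : ℕ × ℕ) : ℝ≥0∞ := (q.1 : ℝ≥0∞) / q.2

theorem value_solve (hD : 0 < D) (f : ℕ → ℕ → ℕ) :
    value (solve n D (table n f)) = sol (Finset.range n) (scaled D (entry (table n f))) n n := by
  obtain ⟨g, hg⟩ : ∃ g, trim n (table n f) = table n g := ⟨_, rfl⟩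
  obtain ⟨h1, h2⟩ := eliminate_spec hD (trim n (trim n (table n f))) (le_refl n)
  rw [solve, eliminate]
  generalize List.foldl _ _ _ = s at *
  obtain ⟨b, p, B⟩ := s
  cases b with
  | false =>
    obtain ⟨l, hl, h⟩ := h2 rfl
    rw [sol_eq_top_of_pivot D f hl h]
    simp [value]
  | true =>
    -- Each trimming transposes the matrix but keeps the component at `n`; `hg` exhibits the trimmed
    -- matrix as a table, so that the lemma applies a second time.
    rw [← sol_trim_self, hg, ← sol_trim_self, ← hg, ← elims_eq_sol,
      (h1 rfl).elims n n le_rfl le_rfl le_rfl le_rfl]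
    simp [value]

theorem solve_snd (hD : 0 < D) (N : List (List ℕ)) :
    0 < (solve n D N).2 ∨ solve n D N = (1, 0) := by
  obtain ⟨h1, h2⟩ := eliminate_spec hD (trim n (trim n N)) (le_refl n)
  rw [solve, eliminate]
  generalize List.foldl _ _ _ = s at *
  obtain ⟨b, p, B⟩ := s
  cases b with
  | false => exact Or.inr rfl
  | true => exact Or.inl (Nat.mul_pos (h1 rfl).pos hD)

end Algorithm

end PGA

namespace StackMachine

open Enc (enc)

/-! ### The running time of the algorithm -/

open PGA.Algorithm PGA.Bareiss

variable {α β γ δ : Type} [Enc α] [Enc β] [Enc γ] [Enc δ]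

theorem foldl_getD {β : Type} (i : ℕ) (l : List β) (m : ℕ) (r : β) :
    l.foldl (fun (c : ℕ × β) b => (c.1 + 1, if c.1 = i then b else c.2)) (m, r) =
      (m + l.length, if i < m then r else l.getD (i - m) r) := by
  induction l generalizing m r with
  | nil => simp
  | cons b l ih =>
    rw [List.foldl_cons, ih, List.length_cons]
    refine Prod.ext (by simp only; omega) ?_
    rcases lt_trichotomy i m with h | rfl | h
    · simp [h, Nat.lt_succ_of_lt h, h.ne']
    · simp
    · rw [if_neg (by omega), if_neg (by omega)]
      simp only [not_lt.2 h.le, if_false]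
      rw [show i - m = (i - (m + 1)) + 1 by omega, List.getD_cons_succ]

theorem esize_getD_le (l : List β) (i : ℕ) (d : β) : esize (l.getD i d) ≤ esize l + esize d := by
  rcases lt_or_ge i l.length with h | h
  · rw [List.getD_eq_getElem _ _ h]
    exact (esize_lt_of_mem (List.getElem_mem h)).le.trans (Nat.le_add_right _ _)
  · rw [List.getD_eq_default _ _ h]
    exact Nat.le_add_left _ _

namespace PolyTime

@[fun_prop]
theorem getD {l : α → List β} {i : α → ℕ} (hl : PolyTime l) (hi : PolyTime i) (d : β) :
    PolyTime fun a => (l a).getD (i a) d := by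
  refine (snd.comp (foldl (s := fun a (c : ℕ × β) b => (c.1 + 1, if c.1 = i a then b else c.2))
    (i := fun _ => (0, d)) hl (.const _)
    (.pair (by fun_prop) (.ite (.decide_eq (by fun_prop) (hi.comp .fst)) (by fun_prop)
      (by fun_prop))) (b := fun a => (4 * esize (l a) + 1) + (esize (l a) + esize d) + 1)
    (((((PolyBounded.const 4).mul hl.polyBounded).add (.const 1)).add
      (hl.polyBounded.add (.const _))).add (.const 1)) fun a l' h => ?_)).congr fun a => ?_
  · rw [foldl_getD, if_neg (Nat.not_lt_zero _), esize_pair]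
    have h1 := esize_getD_le l' (i a - 0) d
    have h2 := esize_le_of_prefix h
    have h3 := esize_nat_le_of_lt_two_pow (n := 0 + l'.length) (b := esize (l a)) (by
      rw [Nat.zero_add]
      exact ((length_lt_esize l').trans_le h2).trans Nat.lt_two_pow_self)
    simp only at h3 ⊢
    omega
  · rw [foldl_getD, if_neg (Nat.not_lt_zero _), Nat.sub_zero]

/-- The range of a number given in binary is exponentially long in general; here a list of that
length is at hand. -/
theorem range_length {l : α → List β} (hl : PolyTime l) :
    PolyTime fun a => List.range (l a).length := by
  have h (l : List β) : l.foldl (fun (c : ℕ × List ℕ) _ => (c.1 + 1, c.1 :: c.2)) (0, []) =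
      (l.length, (List.range l.length).reverse) := by
    induction l using List.reverseRecOn with
    | nil => rfl
    | append_singleton l b ih => simp [ih, List.range_succ]
  refine (snd.comp (foldl (s := fun _ (c : ℕ × List ℕ) _ => (c.1 + 1, c.1 :: c.2))
    (i := fun _ => (0, [])) hl (.const _) (by fun_prop)
    (b := fun a => (4 * esize (l a) + 1) + (esize (l a) * (4 * esize (l a) + 1 + 1) + 1) + 1)
    (((((PolyBounded.const 4).mul hl.polyBounded).add (.const 1)).add
      ((hl.polyBounded.mul ((((PolyBounded.const 4).mul hl.polyBounded).add (.const 1)).add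
        (.const 1))).add (.const 1))).add (.const 1)) fun a l' hl' => ?_)).reverse.congr fun a => ?_
  · rw [h, esize_pair]
    have h1 := hl'.length_le.trans (length_lt_esize _).le
    have h2 : ∀ m ≤ l'.length, esize m ≤ 4 * esize (l a) + 1 := fun m hm =>
      esize_nat_le_of_lt_two_pow ((hm.trans h1).trans_lt Nat.lt_two_pow_self)
    have h3 := esize_le_of_forall_le (List.range l'.length).reverse
      (m := 4 * esize (l a) + 1) fun m hm => h2 m (by simp at hm; omega)
    rw [List.length_reverse, List.length_range] at h3
    exact Nat.add_le_add_right (Nat.add_le_add (h2 _ le_rfl) (h3.trans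
      (Nat.add_le_add_right (Nat.mul_le_mul_right _ h1) 1))) 1
  · rw [h, List.reverse_reverse]

@[fun_prop]
theorem entry {M : α → List (List ℕ)} {i j : α → ℕ} (hM : PolyTime M) (hi : PolyTime i)
    (hj : PolyTime j) : PolyTime fun a => entry (M a) (i a) (j a) :=
  (hM.getD hi []).getD hj 0

theorem table {n : α → ℕ} {f : α → ℕ → ℕ → ℕ}
    (hn : PolyTime fun a => List.range (n a + 1))
    (hf : PolyTime fun p : α × ℕ × ℕ => f p.1 p.2.1 p.2.2) :
    PolyTime fun a => table (n a) (f a) := by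
  refine map (f := fun a i => (List.range (n a + 1)).map fun j => f a i j) hn ?_
  exact map (f := fun (p : α × ℕ) j => f p.1 p.2 j) (hn.comp .fst)
    (hf.comp (f := fun p : (α × ℕ) × ℕ => (p.1.1, p.1.2, p.2)) (by fun_prop))

end PolyTime

/-- A bound for the size of a table. -/
def tableSize (n b : ℕ) : ℕ := (n + 1) * (((n + 1) * ((4 * b + 1) + 1) + 1) + 1) + 1

theorem esize_table_le {n b : ℕ} {f : ℕ → ℕ → ℕ} (h : ∀ i ≤ n, ∀ j ≤ n, f i j < 2 ^ b) :
    esize (table n f) ≤ tableSize n b := by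
  refine (esize_le_of_forall_le (table n f)
    (m := (n + 1) * ((4 * b + 1) + 1) + 1) fun r hr => ?_).trans
    (by rw [PGA.Algorithm.table, List.length_map, List.length_range]; exact le_rfl)
  obtain ⟨i, hi, rfl⟩ := List.mem_map.1 hr
  refine (esize_le_of_forall_le _ (m := 4 * b + 1) fun e he => ?_).trans
    (by rw [List.length_map, List.length_range])
  obtain ⟨j, hj, rfl⟩ := List.mem_map.1 he
  rw [List.mem_range] at hi hj
  exact esize_nat_le_of_lt_two_pow (h i (by omega) j (by omega))

theorem PolyBounded.tableSize {n b : α → ℕ} (hn : PolyBounded n) (hb : PolyBounded b) :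
    PolyBounded fun a => tableSize (n a) (b a) :=
  ((hn.add (.const 1)).mul ((((hn.add (.const 1)).mul (((((PolyBounded.const 4).mul hb).add
    (.const 1))).add (.const 1))).add (.const 1)).add (.const 1))).add (.const 1)

theorem entry_lt_two_pow (M : List (List ℕ)) (i j : ℕ) : entry M i j < 2 ^ (esize M + 2) := by
  refine (lt_two_pow_esize _).trans_le (Nat.pow_le_pow_right (by norm_num) ?_)
  have h1 := esize_getD_le (M.getD i []) j 0
  have h2 := esize_getD_le M i []
  have h3 : esize (0 : ℕ) = 1 := by simp [esize, enc_nat, enc_nil]; rfl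
  rw [esize_nil] at h2
  rw [entry]
  omega

namespace PolyTime

theorem polyBounded_of_range {n : α → ℕ} (hn : PolyTime fun a => List.range (n a)) :
    PolyBounded n :=
  hn.polyBounded.mono fun a => by
    have := length_lt_esize (List.range (n a))
    rw [List.length_range] at this
    exact this.le

theorem closure {n : α → ℕ} {N : α → List (List ℕ)} (hn : PolyTime fun a => List.range (n a))
    (hn' : PolyTime fun a => List.range (n a + 1)) (hN : PolyTime N) :
    PolyTime fun a => closure (n a) (N a) := by
  refine foldl (s := fun a W k => closureStep (n a) W k) hn hN
    (table (α := α × List (List ℕ) × ℕ) (n := fun p => n p.1)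
      (f := fun p i j => if PGA.Algorithm.entry p.2.1 i j = 0 ∧
        (PGA.Algorithm.entry p.2.1 i p.2.2 = 0 ∨
          PGA.Algorithm.entry p.2.1 p.2.2 j = 0) then 0 else 1)
      (hn'.comp .fst) (.ite (by fun_prop) (.const _) (.const _)))
    (b := fun a => esize (N a) + tableSize (n a) 1)
    (hN.polyBounded.add (.tableSize (polyBounded_of_range hn) (.const 1))) fun a l h => ?_
  -- After at least one step all entries are 0 or 1, whatever the initial matrix was.
  rcases List.eq_nil_or_concat l with rfl | ⟨l, k, rfl⟩
  · exact Nat.le_add_right _ _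
  · rw [List.concat_eq_append, List.foldl_append]
    refine le_trans (esize_table_le fun i _ j _ => ?_) (Nat.le_add_left _ _)
    split <;> norm_num

theorem trim {n : α → ℕ} {N : α → List (List ℕ)} (hn : PolyTime fun a => List.range (n a))
    (hn' : PolyTime fun a => List.range (n a + 1)) (hnn : PolyTime n) (hN : PolyTime N) :
    PolyTime fun a => trim (n a) (N a) := by
  have hc := closure hn hn' hN
  refine table (f := fun a i j =>
    if PGA.Algorithm.entry (PGA.Algorithm.closure (n a) (N a)) j (n a) = 0
    then 0 else PGA.Algorithm.entry (N a) j i) hn' ?_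
  have h1 : PolyTime fun p : α × ℕ × ℕ => PGA.Algorithm.closure (n p.1) (N p.1) := hc.comp .fst
  have h2 : PolyTime fun p : α × ℕ × ℕ => N p.1 := hN.comp .fst
  have h3 : PolyTime fun p : α × ℕ × ℕ => n p.1 := hnn.comp .fst
  exact .ite (by fun_prop) (.const _) (by fun_prop)

end PolyTime

/-- While the flag is set, the invariant bounds all numbers by minors. A step that clears the flag,
and every step after it, leaves factor and matrix as they are. -/
theorem esize_foldl_pivotStep_le {n D c k : ℕ} (hD : 0 < D) (hDc : D < 2 ^ c) {N : List (List ℕ)}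
    (hN : ∀ i ≤ n, ∀ j ≤ n, entry N i j < 2 ^ c) (hk : k ≤ n) :
    esize ((List.range k).foldl (pivotStep n D) (true, 1, N)).2.1 ≤
        4 * ((n + 1) * (n + 1) + c * (n + 1) + 1) + 1 ∧
    esize ((List.range k).foldl (pivotStep n D) (true, 1, N)).2.2 ≤
        esize N + tableSize n ((n + 1) * (n + 1) + c * (n + 1) + c + 2) := by
  induction k with
  | zero => exact ⟨(esize_nat_le_of_lt_two_pow (b := 1) (by norm_num)).trans (by omega), by simp⟩
  | succ k ih =>
    have ih := ih (by omega)
    have h1 := (eliminate_spec hD N (show k ≤ n by omega)).1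
    have h1' := (eliminate_spec hD N hk).1
    rw [List.range_succ, List.foldl_append, List.foldl_cons, List.foldl_nil] at h1' ⊢
    generalize (List.range k).foldl (pivotStep n D) (true, 1, N) = s at *
    obtain ⟨b, p, B⟩ := s
    cases b with
    | false => exact ih
    | true =>
      by_cases hle : D * p ≤ PGA.Algorithm.entry B k k
      · simpa only [pivotStep, if_true, if_pos hle] using ih
      · simp only [pivotStep, if_true, if_neg hle] at h1' ⊢
        have h1' := h1' trivial
        constructor
        · refine esize_nat_le_of_lt_two_pow ((h1'.pivot_le hk hDc hN).trans_lt ?_)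
          exact Nat.pow_lt_pow_right (by norm_num) (by omega)
        · refine le_trans (esize_table_le fun i hi j hj => ?_) (Nat.le_add_left _ _)
          split
          · next h =>
            have := h1'.entry_le hk hDc hN h.1 hi h.2 hj
            rw [entry_table _ hi hj, if_pos h] at this
            exact this.trans_lt (Nat.pow_lt_pow_right (by norm_num) (by omega))
          · positivity

namespace PolyTime

theorem eliminate {n D : α → ℕ} {N : α → List (List ℕ)} (hn : PolyTime fun a => List.range (n a))
    (hn' : PolyTime fun a => List.range (n a + 1)) (hD : PolyTime D) (hN : PolyTime N)
    (hpos : ∀ a, 0 < D a) : PolyTime fun a => eliminate (n a) (D a) (N a) := by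
  have hnb := polyBounded_of_range hn
  have hcb : PolyBounded fun a => esize (D a) + esize (N a) + 2 :=
    (hD.polyBounded.add hN.polyBounded).add (.const 2)
  have hbb : PolyBounded fun a => (n a + 1) * (n a + 1) +
      (esize (D a) + esize (N a) + 2) * (n a + 1) :=
    ((hnb.add (.const 1)).mul (hnb.add (.const 1))).add (hcb.mul (hnb.add (.const 1)))
  refine foldl (s := fun a s k => pivotStep (n a) (D a) s k) (i := fun a => (true, 1, N a)) hn
    (.pair (.const _) (.pair (.const _) hN)) ?_
    (b := fun a => 3 + (4 * ((n a + 1) * (n a + 1) +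
      (esize (D a) + esize (N a) + 2) * (n a + 1) + 1) + 1 + (esize (N a) + tableSize (n a)
      ((n a + 1) * (n a + 1) + (esize (D a) + esize (N a) + 2) * (n a + 1) +
        (esize (D a) + esize (N a) + 2) + 2)) + 1) + 1)
    (((PolyBounded.const 3).add (((((PolyBounded.const 4).mul (hbb.add (.const 1))).add
      (.const 1)).add (hN.polyBounded.add (.tableSize hnb ((hbb.add hcb).add (.const 2))))).add
      (.const 1))).add (.const 1)) fun a l h => ?_
  · have h1 : PolyTime fun p : α × (Bool × ℕ × List (List ℕ)) × ℕ => D p.1 := hD.comp .fst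
    have ht : PolyTime fun p : α × (Bool × ℕ × List (List ℕ)) × ℕ =>
        PGA.Algorithm.table (n p.1) fun i j => if p.2.2 < i ∧ p.2.2 < j then
          ((D p.1 * p.2.1.2.1 - PGA.Algorithm.entry p.2.1.2.2 p.2.2 p.2.2) *
            PGA.Algorithm.entry p.2.1.2.2 i j + PGA.Algorithm.entry p.2.1.2.2 i p.2.2 *
            PGA.Algorithm.entry p.2.1.2.2 p.2.2 j) / p.2.1.2.1 else 0 := by
      refine table (hn'.comp .fst) ?_
      have h2 : PolyTime fun p : (α × (Bool × ℕ × List (List ℕ)) × ℕ) × ℕ × ℕ => D p.1.1 :=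
        h1.comp .fst
      exact .ite (by fun_prop) (by fun_prop) (.const _)
    exact .ite_bool (by fun_prop) (.ite (by fun_prop) (by fun_prop) (.pair (.const _)
      (.pair (by fun_prop) ht))) (by fun_prop)
  · obtain ⟨k, hk, rfl⟩ : ∃ k ≤ n a, l = List.range k := by
      refine ⟨l.length, by simpa using h.length_le, ?_⟩
      rw [List.prefix_iff_eq_take.1 h, List.take_range, List.length_range]
    obtain ⟨h1, h2⟩ := esize_foldl_pivotStep_le (c := esize (D a) + esize (N a) + 2) (hpos a)
      ((lt_two_pow_esize _).trans_le (Nat.pow_le_pow_right (by norm_num) (by omega)))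
      (N := N a) (fun i _ j _ => (entry_lt_two_pow (N a) i j).trans_le
        (Nat.pow_le_pow_right (by norm_num) (by omega))) hk
    rw [esize_pair]
    refine Nat.add_le_add_right (Nat.add_le_add (esize_bool_le _) ?_) 1
    rw [esize_pair]
    exact Nat.add_le_add_right (Nat.add_le_add h1 h2) 1

theorem solve {n D : α → ℕ} {N : α → List (List ℕ)} (hn : PolyTime fun a => List.range (n a))
    (hn' : PolyTime fun a => List.range (n a + 1)) (hnn : PolyTime n) (hD : PolyTime D)
    (hN : PolyTime N) (hpos : ∀ a, 0 < D a) : PolyTime fun a => solve (n a) (D a) (N a) := by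
  have h := eliminate hn hn' hD (trim hn hn' hnn (trim hn hn' hnn hN)) hpos
  exact .ite_bool (fst.comp h) (.pair (.entry (snd.comp (snd.comp h)) hnn hnn)
    (.mul (fst.comp (snd.comp h)) hD)) (.const _)

end PolyTime

end StackMachine

namespace PGA

/-! ### The mass as the solution of a linear system -/

open Algorithm LinearSystem Bareiss

/-- The sum of the coefficients is multiplicative. -/
noncomputable def coeffSum (V : Type*) : MvPowerSeries V ℝ≥0∞ →+* ℝ≥0∞ where
  toFun f := ∑' v, MvPowerSeries.coeff v f
  map_zero' := by simp
  map_one' := by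
    classical
    simp only [MvPowerSeries.coeff_one]
    exact tsum_ite_eq 0 1
  map_add' f g := by
    simp only [map_add]
    exact ENNReal.tsum_add
  map_mul' f g := by
    classical
    simp only [MvPowerSeries.coeff_mul]
    -- The antidiagonals partition all pairs of exponents, and sums in [0,∞] may be rearranged
    -- freely.
    calc ∑' v, ∑ p ∈ Finset.HasAntidiagonal.antidiagonal v,
          MvPowerSeries.coeff p.1 f * MvPowerSeries.coeff p.2 g
        = ∑' v, ∑' p : Finset.HasAntidiagonal.antidiagonal v,
            MvPowerSeries.coeff p.1.1 f * MvPowerSeries.coeff p.1.2 g :=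
          tsum_congr fun v => (Finset.tsum_subtype (Finset.HasAntidiagonal.antidiagonal v) fun p =>
            MvPowerSeries.coeff p.1 f * MvPowerSeries.coeff p.2 g).symm
      _ = ∑' q : Σ v, Finset.HasAntidiagonal.antidiagonal v,
            MvPowerSeries.coeff q.2.1.1 f * MvPowerSeries.coeff q.2.1.2 g :=
          (ENNReal.tsum_sigma fun v (p : Finset.HasAntidiagonal.antidiagonal v) =>
            MvPowerSeries.coeff p.1.1 f * MvPowerSeries.coeff p.1.2 g).symm
      _ = ∑' p : (V →₀ ℕ) × (V →₀ ℕ), MvPowerSeries.coeff p.1 f * MvPowerSeries.coeff p.2 g :=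
          Finset.HasAntidiagonal.sigmaAntidiagonalEquivProd.tsum_eq fun p : (V →₀ ℕ) × (V →₀ ℕ) =>
            MvPowerSeries.coeff p.1 f * MvPowerSeries.coeff p.2 g
      _ = (∑' v, MvPowerSeries.coeff v f) * ∑' v, MvPowerSeries.coeff v g := by
          rw [ENNReal.tsum_prod (f := fun a b => MvPowerSeries.coeff a f * MvPowerSeries.coeff b g)]
          simp only [ENNReal.tsum_mul_left, ENNReal.tsum_mul_right]

theorem coeffSum_apply {V : Type*} (f : MvPowerSeries V ℝ≥0∞) :
    coeffSum V f = ∑' v, MvPowerSeries.coeff v f := rfl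

theorem coeffSum_monomial {V : Type*} (v : V →₀ ℕ) (r : ℝ≥0∞) :
    coeffSum V (MvPowerSeries.monomial v r) = r := by
  classical
  rw [coeffSum_apply, tsum_eq_single v fun w hw => ?_]
  · exact MvPowerSeries.coeff_monomial_same v r
  · rw [MvPowerSeries.coeff_monomial, if_neg hw]

/-- The value of a weight if all symbols are replaced by `1`. -/
noncomputable def RationalWeight.value {k : ℕ} (w : RationalWeight k) : ℝ≥0∞ :=
  (w.coefficient.num : ℝ≥0∞) / w.coefficient.den

theorem Fraction.coe_toNNReal (q : Fraction) :
    (q.toNNReal : ℝ≥0∞) = (q.num : ℝ≥0∞) / q.den := by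
  have := q.den_pos
  rw [Fraction.toNNReal, ENNReal.coe_div (by positivity), ENNReal.coe_natCast, ENNReal.coe_natCast]

theorem RationalWeight.coeffSum_toSeries {k : ℕ} (w : RationalWeight k) :
    coeffSum (Fin k) w.toSeries = w.value := by
  obtain ⟨q, _ | X⟩ := w <;>
    simp only [RationalWeight.toSeries, RationalWeight.value, coeffSum_monomial,
      Fraction.coe_toNNReal]

theorem coeffSum_matrixStar {V Q : Type*} [Fintype Q] [DecidableEq Q]
    (M : Matrix Q Q (MvPowerSeries V ℝ≥0∞)) (s t : Q) :
    coeffSum V (matrixStar M s t) = ∑' m : ℕ, ((coeffSum V).mapMatrix M ^ m) s t := by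
  simp only [← map_pow]
  exact ENNReal.tsum_comm

theorem mass_toAutomaton (A : RationalAutomaton) : mass A.toAutomaton =
    ∑' m : ℕ, ∑ s, (A.initial s).value *
      ((Matrix.of fun s t => (A.transition s t).value) ^ m).mulVec
        (fun t => (A.final t).value) s := by
  have hM : (coeffSum (Fin A.numSymbols)).mapMatrix A.toAutomaton.transition =
      Matrix.of fun s t => (A.transition s t).value := by
    ext s t
    exact (A.transition s t).coeffSum_toSeries
  rw [mass, ← coeffSum_apply, behavior, map_sum,
    Summable.tsum_finsetSum fun _ _ => ENNReal.summable]
  refine Finset.sum_congr rfl fun s _ => ?_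
  rw [map_sum, ENNReal.tsum_mul_left]
  simp only [Matrix.mulVec, dotProduct]
  rw [Summable.tsum_finsetSum fun _ _ => ENNReal.summable, Finset.mul_sum]
  refine Finset.sum_congr rfl fun t _ => ?_
  rw [map_mul, map_mul, coeffSum_matrixStar, hM, ENNReal.tsum_mul_right, mul_assoc]
  congr 1
  · exact (A.initial s).coeffSum_toSeries
  · congr 1
    exact (A.final t).coeffSum_toSeries

/-- Term `m + 1` of the series for `sol` is I Pᵐ F: one edge leaves the added index, m edges stay
among the states, one edge returns. Term 0 is the entry at the corner, which is zero. -/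
theorem sol_eq_tsum_mulVec {n : ℕ} {G : ℕ → ℕ → ℝ≥0∞} {P : Matrix (Fin n) (Fin n) ℝ≥0∞}
    {I F : Fin n → ℝ≥0∞} (hP : ∀ s t : Fin n, G s t = P s t) (hI : ∀ s : Fin n, G n s = I s)
    (hF : ∀ s : Fin n, G s n = F s) (h0 : G n n = 0) :
    sol (Finset.range n) G n n = ∑' m : ℕ, ∑ s, I s * (P ^ m).mulVec F s := by
  have hact (m : ℕ) (s : Fin n) : (act (Finset.range n) G)^[m] (fun i => G i n) s =
      (P ^ m).mulVec F s := by
    induction m generalizing s with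
    | zero => rw [pow_zero, Matrix.one_mulVec]; exact hF s
    | succ m ih =>
      rw [Function.iterate_succ_apply', act, Finset.sum_range, pow_succ', ← Matrix.mulVec_mulVec]
      exact Finset.sum_congr rfl fun t _ => by rw [ih, hP]
  rw [sol, tsum_eq_zero_add' ENNReal.summable, Function.iterate_zero, id_eq, h0, zero_add]
  refine tsum_congr fun m => ?_
  rw [Function.iterate_succ_apply', act, Finset.sum_range]
  exact Finset.sum_congr rfl fun s _ => by rw [hact, hI]

/-! ### The matrix of an automaton -/

/-- Blocks of constant length make the position of every weight in the encoding an explicit linear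
expression. -/
theorem getD_flatten {α : Type*} {c : ℕ} (L : List (List α)) (h : ∀ l ∈ L, l.length = c) (i r : ℕ)
    (hr : r < c) (d : α) : L.flatten.getD (c * i + r) d = (L.getD i []).getD r d := by
  induction L generalizing i with
  | nil => simp
  | cons l L ih =>
    have hl := h l List.mem_cons_self
    rw [List.flatten_cons]
    cases i with
    | zero =>
      rw [List.getD_append _ _ _ _ (by omega), Nat.mul_zero, Nat.zero_add, List.getD_cons_zero]
    | succ i =>
      rw [List.getD_append_right _ _ _ _ (by rw [hl, Nat.mul_succ]; omega), hl,
        show c * (i + 1) + r - c = c * i + r by rw [Nat.mul_succ]; omega,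
        ih fun l hl => h l (List.mem_cons_of_mem _ hl), List.getD_cons_succ]

theorem getD_ofFn {α : Type*} {n : ℕ} (f : Fin n → α) (i : Fin n) (d : α) :
    (List.ofFn f).getD i d = f i := by
  simp [List.getD_eq_getElem?_getD]

theorem getD_flatten_ofFn {α : Type*} {c n : ℕ} (f : Fin n → List α) (h : ∀ i, (f i).length = c)
    (i : Fin n) {r : ℕ} (hr : r < c) (d : α) :
    (List.ofFn f).flatten.getD (c * i + r) d = (f i).getD r d := by
  rw [getD_flatten _ (fun l hl => ?_) _ _ hr, getD_ofFn]
  obtain ⟨i, rfl⟩ := (List.mem_ofFn' _ _).1 hl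
  exact h i

theorem length_flatten_ofFn {α : Type*} {c n : ℕ} (f : Fin n → List α) (h : ∀ i, (f i).length = c) :
    (List.ofFn f).flatten.length = c * n := by
  rw [List.length_flatten, List.map_ofFn, List.sum_ofFn]
  simp [h, mul_comm]

namespace RationalAutomaton

variable (A : RationalAutomaton)

/-- The numbers in the encoding of an automaton. -/
def toNats : List ℕ :=
  [A.numStates, A.numSymbols] ++
    (List.ofFn fun s => (A.initial s).toNats).flatten ++
    (List.ofFn fun s => (A.final s).toNats).flatten ++
    (List.ofFn fun s => (List.ofFn fun t => (A.transition s t).toNats).flatten).flatten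

theorem length_toNats : A.toNats.length =
    2 + 3 * A.numStates + 3 * A.numStates + 3 * A.numStates * A.numStates := by
  simp only [toNats, List.length_append]
  rw [length_flatten_ofFn (c := 3) _ fun _ => rfl, length_flatten_ofFn (c := 3) _ fun _ => rfl,
    length_flatten_ofFn (c := 3 * A.numStates) _ fun s =>
      length_flatten_ofFn (c := 3) _ fun _ => rfl]
  rfl

theorem toNats_initial (s : Fin A.numStates) {r : ℕ} (hr : r < 3) :
    A.toNats.getD (2 + 3 * s + r) 0 = (A.initial s).toNats.getD r 0 := by
  have h1 := length_flatten_ofFn (c := 3) (fun s => (A.initial s).toNats) fun _ => rfl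
  have := s.2
  rw [toNats, List.append_assoc, List.append_assoc, List.getD_append_right _ _ _ _ (by simp; omega),
    List.getD_append _ _ _ _ (by rw [h1]; simp; omega),
    ← getD_flatten_ofFn (fun s => (A.initial s).toNats) (fun _ => rfl) s hr]
  congr 1
  simp
  omega

theorem toNats_final (s : Fin A.numStates) {r : ℕ} (hr : r < 3) :
    A.toNats.getD (2 + 3 * A.numStates + 3 * s + r) 0 = (A.final s).toNats.getD r 0 := by
  have h1 := length_flatten_ofFn (c := 3) (fun s => (A.initial s).toNats) fun _ => rfl
  have h2 := length_flatten_ofFn (c := 3) (fun s => (A.final s).toNats) fun _ => rfl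
  have := s.2
  rw [toNats, List.append_assoc, List.getD_append_right _ _ _ _ (by
    rw [List.length_append, h1]; simp; omega),
    List.getD_append _ _ _ _ (by rw [h2, List.length_append, h1]; simp; omega),
    ← getD_flatten_ofFn (fun s => (A.final s).toNats) (fun _ => rfl) s hr]
  congr 1
  rw [List.length_append, h1]
  simp
  omega

theorem toNats_transition (s t : Fin A.numStates) {r : ℕ} (hr : r < 3) :
    A.toNats.getD (2 + 6 * A.numStates + 3 * (s * A.numStates + t) + r) 0 =
      (A.transition s t).toNats.getD r 0 := by
  have h1 := length_flatten_ofFn (c := 3) (fun s => (A.initial s).toNats) fun _ => rfl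
  have h2 := length_flatten_ofFn (c := 3) (fun s => (A.final s).toNats) fun _ => rfl
  have := t.2
  rw [toNats, List.getD_append_right _ _ _ _ (by
    rw [List.length_append, List.length_append, h1, h2]; simp; omega),
    ← getD_flatten_ofFn (fun t => (A.transition s t).toNats) (fun _ => rfl) t hr,
    ← getD_flatten_ofFn (c := 3 * A.numStates)
      (fun s => (List.ofFn fun t => (A.transition s t).toNats).flatten)
      (fun s => length_flatten_ofFn (c := 3) _ fun _ => rfl) s (by omega)]
  congr 1
  rw [List.length_append, List.length_append, h1, h2]
  simp only [List.length_cons, List.length_nil]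
  have : 3 * (s * A.numStates + t) = 3 * A.numStates * s + 3 * t := by ring
  omega

/-! ### Clearing denominators -/

/-- A common multiple of the positive numbers in the encoding. -/
def denominator : ℕ := A.toNats.foldl (fun d e => if e = 0 then d else d * e) 1

/-- Multiplying all positive numbers, and not only the denominators, avoids selecting positions and
still gives a common multiple. -/
theorem foldl_denominator (l : List ℕ) (d : ℕ) :
    (0 < d → 0 < l.foldl (fun d e => if e = 0 then d else d * e) d) ∧
    d ∣ l.foldl (fun d e => if e = 0 then d else d * e) d ∧
    ∀ e ∈ l, 0 < e → e ∣ l.foldl (fun d e => if e = 0 then d else d * e) d := by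
  induction l generalizing d with
  | nil => simp
  | cons a l ih =>
    obtain ⟨h1, h2, h3⟩ := ih (if a = 0 then d else d * a)
    refine ⟨fun hd => h1 ?_, dvd_trans ?_ h2, fun e he hpos => ?_⟩
    · split
      · exact hd
      · exact Nat.mul_pos hd (by omega)
    · split
      · exact dvd_rfl
      · exact dvd_mul_right _ _
    · rcases List.mem_cons.1 he with rfl | he
      · refine dvd_trans ?_ h2
        rw [if_neg hpos.ne']
        exact dvd_mul_left _ _
      · exact h3 e he hpos

theorem denominator_pos : 0 < A.denominator := (foldl_denominator _ _).1 one_pos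

theorem getD_dvd_denominator {i : ℕ} (h : 0 < A.toNats.getD i 0) :
    A.toNats.getD i 0 ∣ A.denominator := by
  rcases lt_or_ge i A.toNats.length with hi | hi
  · rw [List.getD_eq_getElem _ _ hi] at h ⊢
    exact (foldl_denominator _ _).2.2 _ (List.getElem_mem hi) h
  · rw [List.getD_eq_default _ _ hi] at h
    exact absurd h (lt_irrefl 0)

/-- The fraction at the position `i` of the encoding, multiplied by the denominator. -/
def scaledWeight (i : ℕ) : ℕ := A.toNats.getD i 0 * (A.denominator / A.toNats.getD (i + 1) 0)

theorem scaledWeight_div {k : ℕ} (w : RationalWeight k) {i : ℕ}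
    (h : ∀ r < 3, A.toNats.getD (i + r) 0 = w.toNats.getD r 0) :
    (A.scaledWeight i : ℝ≥0∞) / A.denominator = w.value := by
  have h0 : A.toNats.getD i 0 = w.coefficient.num := h 0 (by norm_num)
  have h1 : A.toNats.getD (i + 1) 0 = w.coefficient.den := h 1 (by norm_num)
  have hpos := w.coefficient.den_pos
  have hd := A.denominator_pos
  obtain ⟨c, hc⟩ := A.getD_dvd_denominator (h1 ▸ hpos)
  rw [scaledWeight, h0, h1, RationalWeight.value]
  rw [h1] at hc
  rw [hc] at hd ⊢
  have hc0 : 0 < c := Nat.pos_of_mul_pos_left hd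
  rw [Nat.mul_div_cancel_left _ hpos, Nat.cast_mul, Nat.cast_mul, ENNReal.mul_div_mul_right]
  · exact_mod_cast hc0.ne'
  · exact ENNReal.natCast_ne_top c

/-- The scaled matrix of an automaton, whose last row and column contain the initial and the final
weights. -/
def matrix : List (List ℕ) :=
  table A.numStates fun i j =>
    if i = A.numStates then
      if j = A.numStates then 0 else A.scaledWeight (2 + 3 * j)
    else if j = A.numStates then A.scaledWeight (2 + 3 * A.numStates + 3 * i)
    else A.scaledWeight (2 + 6 * A.numStates + 3 * (i * A.numStates + j))

/-- The mass as numerator and denominator, where `1 / 0` stands for `∞`. -/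
def solution : ℕ × ℕ := solve A.numStates A.denominator A.matrix

theorem value_solution : value A.solution = mass A.toAutomaton := by
  rw [solution, matrix, value_solve A.denominator_pos, mass_toAutomaton]
  refine sol_eq_tsum_mulVec (fun s t => ?_) (fun s => ?_) (fun s => ?_) ?_
  · rw [scaled, entry_table _ s.2.le t.2.le, if_neg s.2.ne, if_neg t.2.ne]
    exact A.scaledWeight_div _ fun r hr => A.toNats_transition s t hr
  · rw [scaled, entry_table _ le_rfl s.2.le, if_pos rfl, if_neg s.2.ne]
    exact A.scaledWeight_div _ fun r hr => A.toNats_initial s hr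
  · rw [scaled, entry_table _ s.2.le le_rfl, if_neg s.2.ne, if_pos rfl]
    exact A.scaledWeight_div _ fun r hr => A.toNats_final s hr
  · rw [scaled, entry_table _ le_rfl le_rfl, if_pos rfl, if_pos rfl, Nat.cast_zero,
      ENNReal.zero_div]

/-- The mass of an automaton. -/
def result : ExtFraction :=
  if h : 0 < A.solution.2 then some ⟨A.solution.1, A.solution.2, h⟩ else none

theorem solution_snd : 0 < A.solution.2 ∨ A.solution = (1, 0) := solve_snd A.denominator_pos _

theorem toENNReal_result : A.result.toENNReal = mass A.toAutomaton := by
  rw [← A.value_solution, result]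
  split
  · rw [ExtFraction.toENNReal, Fraction.coe_toNNReal, value]
  · next h =>
    rw [A.solution_snd.resolve_left h]
    simp [ExtFraction.toENNReal, value]

/-- A vanishing second component occurs only in the pair `(1, 0)`, which is already the code of ∞,
so the machine need not branch. -/
theorem encode_result : A.result.encode = encodeNats [A.solution.1, A.solution.2] := by
  rw [result]
  split
  · rfl
  · next h =>
    rw [A.solution_snd.resolve_left h]
    rfl

end RationalAutomaton

end PGA

namespace StackMachine

open Enc (enc)

open Computability Turing Turing.TM2

/-! ### Input and output -/

/-- The symbols for digits and commas. -/
def symbol : Option Bool → Γ'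
  | some b => .bit b
  | none => .comma

def ofSymbol : Γ' → Option Bool
  | .bit b => some b
  | _ => none

theorem ofSymbol_symbol (o : Option Bool) : ofSymbol (symbol o) = o := by cases o <;> rfl

/-- Replace the word on the stack `io` by a list on the main stack. -/
def readInput : Prog :=
  .seq (pour .io (.push .fst)) <| .seq (.push .main (.bit false)) <|
    pour .fst fun x => PolyTime.pushWord (.bit true :: (enc (ofSymbol x)).word)

theorem runs_pour_io_fst (u a : List Γ') :
    Runs (pour .io (.push .fst)) ⟨u, [], a, [], []⟩ (St [] (u.reverse ++ a) [])
      (2 * u.length + 1) := by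
  induction u generalizing a with
  | nil => exact .loop_exit _ rfl
  | cons x u ih =>
    rw [List.reverse_cons, List.append_assoc]
    exact (Runs.loop_step (m := 1) rfl (.push _ _ _) (ih _)).mono (by simp; omega)

theorem esize_option_bool_le (o : Option Bool) : esize o ≤ 5 := by
  rcases o with _ | _ | _ <;> decide

theorem runs_pour_fst_list (u v : List (Option Bool)) :
    Runs (pour .fst fun x => PolyTime.pushWord (.bit true :: (enc (ofSymbol x)).word))
      (St (enc v).word (u.map symbol) []) (St (enc (u.reverse ++ v)).word [] [])
      (8 * u.length + 1) := by
  induction u generalizing v with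
  | nil => exact .loop_exit _ rfl
  | cons o u ih =>
    rw [List.reverse_cons, List.append_assoc]
    refine (Runs.loop_step (m := 7) rfl ?_ (ih (o :: v))).mono (by simp; omega)
    have h := PolyTime.runs_pushWord (.bit true :: (enc o).word) (enc v).word (u.map symbol) []
    have hs := esize_option_bool_le o
    rw [List.cons_append, ← Data.word, ← enc_cons] at h
    simp only [List.map_cons, Stacks.get, Stacks.set, List.head?_cons, List.tail_cons,
      ofSymbol_symbol]
    exact h.mono (by rw [List.length_cons]; rw [esize, Data.size] at hs; omega)

theorem runs_readInput (u : List (Option Bool)) :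
    Runs readInput ⟨u.map symbol, [], [], [], []⟩ (St (enc u).word [] [])
      (10 * u.length + 3) := by
  have h := runs_pour_fst_list u.reverse []
  rw [List.reverse_reverse, List.append_nil, List.map_reverse, List.length_reverse] at h
  have h' := runs_pour_io_fst (u.map symbol) []
  rw [List.append_nil, List.length_map] at h'
  exact (h'.seq (Runs.seq (.push _ _ _) h)).mono (by omega)

/-- Move the element of a list from the main stack to the first auxiliary stack, as a symbol. -/
def writeSymbol : Prog :=
  .pop .main fun
    | some (.bit true) => .pop .main fun
      | some (.bit true) =>
        .seq popMain (.seq popMain (.seq popMain (.push .fst (.bit true))))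
      | _ => .seq popMain (.push .fst (.bit false))
    | _ => .push .fst .comma

/-- The trees of `none`, `some false` and `some true` have 1, 3 and 5 symbols, and the first two
symbols tell them apart. -/
theorem runs_writeSymbol (o : Option Bool) (r a : List Γ') :
    Runs writeSymbol (St ((enc o).word ++ r) a []) (St r (symbol o :: a) []) 9 := by
  rcases o with _ | _ | _
  · exact Runs.mono (.pop (.push _ _ _)) (by norm_num)
  · exact Runs.mono (.pop (.pop ((runs_popMain _ _ _ _).seq (.push _ _ _)))) (by norm_num)
  · exact Runs.mono (.pop (.pop ((runs_popMain _ _ _ _).seq ((runs_popMain _ _ _ _).seq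
      ((runs_popMain _ _ _ _).seq (.push _ _ _)))))) (by norm_num)

/-- Replace the list on the main stack by a word on the stack `io`. -/
def writeOutput : Prog :=
  .seq (.loop .main (fun o => o != some (.bit true)) fun _ => writeSymbol)
    (pour .fst (.push .io))

theorem runs_loop_writeSymbol (u : List (Option Bool)) (a : List Γ') :
    Runs (.loop .main (fun o => o != some (.bit true)) fun _ => writeSymbol)
      (St (enc u).word a []) (St [] ((u.map symbol).reverse ++ a) []) (10 * u.length + 1) := by
  induction u generalizing a with
  | nil => exact .loop_exit _ rfl
  | cons o u ih =>
    rw [List.map_cons, List.reverse_cons, List.append_assoc, enc_cons, Data.word]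
    exact (Runs.loop_step (by simp [Stacks.get]) (runs_writeSymbol o _ a) (ih _)).mono
      (by simp; omega)

theorem runs_pour_fst_io (u v : List Γ') :
    Runs (pour .fst (.push .io)) ⟨v, [], u, [], []⟩ ⟨u.reverse ++ v, [], [], [], []⟩
      (2 * u.length + 1) := by
  induction u generalizing v with
  | nil => exact .loop_exit _ rfl
  | cons x u ih =>
    rw [List.reverse_cons, List.append_assoc]
    exact (Runs.loop_step (m := 1) rfl (.push _ _ _) (ih _)).mono (by simp; omega)

theorem runs_writeOutput (u : List (Option Bool)) :
    Runs writeOutput (St (enc u).word [] []) ⟨u.map symbol, [], [], [], []⟩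
      (12 * u.length + 2) := by
  have h := runs_pour_fst_io (u.map symbol).reverse []
  rw [List.reverse_reverse, List.append_nil, List.length_reverse, List.length_map] at h
  have h' := runs_loop_writeSymbol u []
  rw [List.append_nil] at h'
  exact (h'.seq h).mono (by omega)

/-- A function is computable in polynomial time if it is so in terms of the lists of symbols. -/
theorem PolyTime.tm2ComputableInPolyTime {α β : Type} [Enc α] {ea : α → List Γ'}
    {eb : β → List Γ'} {f : α → β} {ia oa : α → List (Option Bool)}
    (hia : ∀ a, ea a = (ia a).map symbol) (henc : ∀ a, enc a = enc (ia a))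
    (hoa : ∀ a, eb (f a) = (oa a).map symbol) (h : PolyTime oa) :
    Nonempty (TM2ComputableInPolyTime ea eb f) := by
  obtain ⟨p, B, ⟨q, hq⟩, hp⟩ := h
  -- A word of length m becomes a tree of size at most 6m + 1. The factor 13 is one share for `p`
  -- and 12 for writing an output no longer than the bound of `p`; 6 collects the constants and the
  -- halting step.
  have key (a : α) : Nonempty (TM2OutputsInTime (toFinTM2 (.seq readInput (.seq p writeOutput)))
      (ea a) (Option.some (eb (f a)))
      ((10 * .X + 13 * q.comp (6 * .X + 1) + 6 : Polynomial ℕ).eval (ea a).length)) := by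
    have h2 := (hp a).2 []
    rw [List.append_nil, List.append_nil, henc a] at h2
    obtain ⟨m, hm, e⟩ := (runs_readInput (ia a)).seq (h2.seq (runs_writeOutput (oa a)))
    rw [← hia, ← hoa] at e
    obtain ⟨o⟩ := outputs_of_exec e
    refine ⟨⟨o.toEvalsTo, o.steps_le_m.trans ?_⟩⟩
    have h3 : esize a ≤ 6 * (ea a).length + 1 := by
      rw [esize, henc, hia, List.length_map, ← esize]
      have := esize_le_of_forall_le (ia a) fun o _ => esize_option_bool_le o
      omega
    have h4 := (hq a).trans (Polynomial.eval_le_eval q h3)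
    have h5 := (length_lt_esize (oa a)).le.trans (hp a).1
    have h6 : (ea a).length = (ia a).length := by rw [hia, List.length_map]
    simp only [Polynomial.eval_add, Polynomial.eval_mul, Polynomial.eval_comp, Polynomial.eval_X,
      Polynomial.eval_ofNat, Polynomial.eval_one]
    omega
  exact ⟨{
    tm := toFinTM2 (.seq readInput (.seq p writeOutput))
    inputAlphabet := Equiv.refl _
    outputAlphabet := Equiv.refl _
    time := 10 * .X + 13 * q.comp (6 * .X + 1) + 6
    outputsFun := fun a => by
      have := (key a).some
      rw [← List.map_id (ea a), ← List.map_id (eb (f a)), List.length_map] at this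
      exact this }⟩

/-! ### Lists of numbers -/

/-- The digits of the numbers, each number followed by `none`. -/
def tokens (l : List ℕ) : List (Option Bool) := l.flatMap fun n => n.bits.map some ++ [none]

def parseStep (c : List Bool × List ℕ) : Option Bool → List Bool × List ℕ
  | some b => (b :: c.1, c.2)
  | none => ([], ofDigits c.1 :: c.2)

/-- The numbers with the given digits. -/
def parse (t : List (Option Bool)) : List ℕ := (t.foldl parseStep ([], [])).2.reverse

theorem foldl_parseStep_some (l : List Bool) (c : List Bool × List ℕ) :
    (l.map some).foldl parseStep c = (l.reverse ++ c.1, c.2) := by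
  induction l generalizing c with
  | nil => rfl
  | cons b l ih => rw [List.map_cons, List.foldl_cons, ih]; simp [parseStep]

theorem parse_tokens (l : List ℕ) : parse (tokens l) = l := by
  suffices h : ∀ m, (tokens l).foldl parseStep ([], m) = ([], l.reverse ++ m) by
    rw [parse, h, List.append_nil, List.reverse_reverse]
  induction l with
  | nil => intro m; rfl
  | cons n l ih =>
    intro m
    rw [tokens, List.flatMap_cons, List.foldl_append, List.foldl_append, foldl_parseStep_some,
      List.append_nil, List.foldl_cons, List.foldl_nil, parseStep, ofDigits_reverse_bits, ← tokens,
      ih, List.reverse_cons, List.append_assoc, List.singleton_append]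

/-- Weight 4 for each pending digit is a potential: a finished number of that many digits needs only
4 per digit and a constant, which its separator pays. -/
theorem esize_foldl_parseStep_le (t : List (Option Bool)) :
    esize (t.foldl parseStep ([], [])) ≤ 4 * t.length + 3 := by
  suffices h : 4 * (t.foldl parseStep ([], [])).1.length + esize (t.foldl parseStep ([], [])).2 ≤
      4 * t.length + 1 by
    have := esize_le_of_forall_le (t.foldl parseStep ([], [])).1 fun b _ => esize_bool_le b
    rw [esize_pair]
    omega
  induction t using List.reverseRecOn with
  | nil => exact le_rfl
  | append_singleton t o ih =>
    rw [List.foldl_append, List.foldl_cons, List.foldl_nil, List.length_append,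
      List.length_singleton]
    generalize t.foldl parseStep ([], []) = c at ih ⊢
    cases o with
    | some b => simp only [parseStep, List.length_cons]; omega
    | none =>
      have := esize_nat_le_of_lt_two_pow (ofDigits_lt c.1)
      simp only [parseStep, List.length_nil, esize_cons]
      omega

namespace PolyTime

variable {α : Type} [Enc α]

theorem parse : PolyTime parse := by
  have hs : PolyTime fun p : List (Option Bool) × (List Bool × List ℕ) × Option Bool =>
      parseStep p.2.1 p.2.2 := by
    -- An option and the list of its elements have the same tree, so a case distinction on options
    -- is one on lists.
    have ht : PolyTime (Option.toList : Option Bool → List Bool) :=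
      of_enc_eq fun o => by cases o <;> rfl
    refine list_cases (l := fun p => p.2.2.toList) (ht.comp (by fun_prop))
      (f := fun p => ([], StackMachine.ofDigits p.2.1.1 :: p.2.1.2)) (by fun_prop)
      (g := fun p => (p.2.1 :: p.1.2.1.1, p.1.2.1.2)) (by fun_prop) ?_ ?_
    · rintro ⟨t, c, _ | b⟩ h
      · rfl
      · simp at h
    · rintro ⟨t, c, _ | b⟩ b' l h
      · simp at h
      · obtain ⟨rfl, -⟩ := List.cons.inj h
        rfl
  have h := foldl (l := fun t : List (Option Bool) => t) (i := fun _ => ([], []))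
    (s := fun _ => parseStep) .id (.const _) hs (b := fun t => 4 * esize t + 3)
    (((PolyBounded.const 4).mul .size).add (.const 3)) fun t l hl =>
      (esize_foldl_parseStep_le l).trans (by
        have := hl.length_le
        have := length_lt_esize t
        omega)
  exact (snd.comp h).reverse

theorem tokens_pair {m n : α → ℕ} (hm : PolyTime m) (hn : PolyTime n) :
    PolyTime fun a => tokens [m a, n a] := by
  have h {m : α → ℕ} (hm : PolyTime m) : PolyTime fun a => (m a).bits.map Option.some ++ [none] :=
    .append (.map (f := fun _ b => Option.some b) hm.bits (by fun_prop)) (.const _)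
  exact (append (h hm) (h hn)).congr fun a => by simp [tokens]

theorem filter_lt_range {m n : ℕ} (h : n ≤ m) :
    (List.range m).filter (fun i => decide (i < n)) = List.range n := by
  induction m, h using Nat.le_induction with
  | base => exact List.filter_eq_self.2 fun i hi => by simpa using hi
  | succ m h ih =>
    rw [List.range_succ, List.filter_append, ih, List.filter_singleton,
      decide_eq_false (not_lt.2 h), cond_false, List.append_nil]

/-- Filter the range of the length of `l`; the hypothesis ensures that nothing is missing. -/
theorem range_of_le_length {l : α → List ℕ} {n : α → ℕ} (hl : PolyTime l) (hn : PolyTime n)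
    (h : ∀ a, n a ≤ (l a).length) : PolyTime fun a => List.range (n a) :=
  (filter (f := fun a i => decide (i < n a)) hl.range_length (by fun_prop)).congr fun a =>
    (filter_lt_range (h a)).symm

end PolyTime

end StackMachine

namespace PGA

/-! ### The encoding of automata and the assembled machine -/

open Computability StackMachine StackMachine.Enc

theorem encodePosNum_eq_bits (p : PosNum) : encodePosNum p = (p : ℕ).bits := by
  induction p with
  | one => simp [encodePosNum]
  | bit0 p ih => rw [encodePosNum, ih, PosNum.cast_bit0, ← two_mul, Nat.bit0_bits _ p.cast_pos.ne']
  | bit1 p ih => rw [encodePosNum, ih, PosNum.cast_bit1, ← two_mul, Nat.bit1_bits]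

theorem encodeNat_eq_bits (n : ℕ) : encodeNat n = n.bits := by
  have h (m : Num) : encodeNum m = (m : ℕ).bits := by
    cases m with
    | zero => simp [encodeNum]
    | pos p => exact encodePosNum_eq_bits p
  rw [encodeNat, h, Num.to_of_nat]

theorem encodeNats_eq (l : List ℕ) : encodeNats l = (tokens l).map symbol := by
  rw [encodeNats, tokens, List.map_flatMap]
  refine congrArg (l.flatMap ·) (funext fun n => ?_)
  rw [encodeNat_eq_bits, List.map_append, List.map_map]
  rfl

namespace RationalAutomaton

/-- The presentation is the list of input symbols itself, so it is exactly what `readInput` produces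
and the numbers are recovered by parsing. -/
instance : Enc RationalAutomaton := ⟨fun A => enc (tokens A.toNats)⟩

theorem polyTime_toNats : PolyTime toNats :=
  (PolyTime.parse.comp (f := fun A : RationalAutomaton => tokens A.toNats)
    (.of_enc_eq fun _ => rfl)).congr fun _ => (parse_tokens _).symm

theorem polyTime_numStates : PolyTime numStates :=
  polyTime_toNats.getD (.const 0) 0

theorem numStates_succ_le_length (A : RationalAutomaton) : A.numStates + 1 ≤ A.toNats.length := by
  rw [length_toNats]
  omega

theorem polyTime_range_succ : PolyTime fun A => List.range (numStates A + 1) :=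
  .range_of_le_length polyTime_toNats (polyTime_numStates.add (.const 1)) numStates_succ_le_length

theorem polyTime_range : PolyTime fun A => List.range (numStates A) :=
  .range_of_le_length polyTime_toNats polyTime_numStates fun _ =>
    (Nat.le_succ _).trans (numStates_succ_le_length _)

/-- The lengths of the factors add up, so the product is no longer than the list, also for every
prefix that the fold passes through. -/
theorem foldl_denominator_lt (l : List ℕ) :
    l.foldl (fun d e => if e = 0 then d else d * e) 1 < 2 ^ esize l := by
  induction l using List.reverseRecOn with
  | nil => decide
  | append_singleton l e ih =>
    have h1 := esize_append l [e]
    rw [esize_cons, esize_nil] at h1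
    rw [List.foldl_append, List.foldl_cons, List.foldl_nil]
    split
    · exact ih.trans_le (Nat.pow_le_pow_right (by norm_num) (by omega))
    · calc _ < 2 ^ esize l * 2 ^ esize e := Nat.mul_lt_mul'' ih (lt_two_pow_esize e)
        _ = 2 ^ (esize l + esize e) := (pow_add _ _ _).symm
        _ ≤ _ := Nat.pow_le_pow_right (by norm_num) (by omega)

theorem polyTime_denominator : PolyTime denominator :=
  .foldl (s := fun _ d e => if e = 0 then d else d * e) (i := fun _ => 1) polyTime_toNats (.const 1)
    (by fun_prop) (b := fun A => 4 * esize A.toNats + 1)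
    (((PolyBounded.const 4).mul polyTime_toNats.polyBounded).add (.const 1)) fun _ l hl => by
      have := esize_nat_le_of_lt_two_pow (foldl_denominator_lt l)
      have := esize_le_of_prefix hl
      omega

theorem polyTime_scaledWeight {α : Type} [Enc α] {A : α → RationalAutomaton} {i : α → ℕ}
    (hA : PolyTime A) (hi : PolyTime i) : PolyTime fun a => (A a).scaledWeight (i a) :=
  have h := polyTime_toNats.comp hA
  (h.getD hi 0).mul ((polyTime_denominator.comp hA).div (h.getD (hi.add (.const 1)) 0))

theorem polyTime_matrix : PolyTime matrix := by
  have hn : PolyTime fun p : RationalAutomaton × ℕ × ℕ => p.1.numStates :=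
    polyTime_numStates.comp .fst
  refine .table (f := fun A i j =>
    if i = A.numStates then
      if j = A.numStates then 0 else A.scaledWeight (2 + 3 * j)
    else if j = A.numStates then A.scaledWeight (2 + 3 * A.numStates + 3 * i)
    else A.scaledWeight (2 + 6 * A.numStates + 3 * (i * A.numStates + j))) polyTime_range_succ ?_
  exact .ite (by fun_prop) (.ite (by fun_prop) (.const 0)
      (polyTime_scaledWeight .fst (by fun_prop)))
    (.ite (by fun_prop) (polyTime_scaledWeight .fst (by fun_prop))
      (polyTime_scaledWeight .fst (by fun_prop)))

theorem polyTime_solution : PolyTime solution :=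
  .solve polyTime_range polyTime_range_succ polyTime_numStates polyTime_denominator polyTime_matrix
    denominator_pos

end RationalAutomaton

end PGA

/-- A single multi-stack Turing machine computes, in time polynomial in the length of the binary
encoding of an automaton with rational weights, the exact total mass of its behavior. -/
theorem mainTheorem6 :
    ∃ f : PGA.RationalAutomaton → PGA.ExtFraction,
      Nonempty (Turing.TM2ComputableInPolyTime
        PGA.RationalAutomaton.encode PGA.ExtFraction.encode f) ∧
      ∀ A : PGA.RationalAutomaton, (f A).toENNReal = PGA.mass A.toAutomaton :=
  ⟨PGA.RationalAutomaton.result,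
    StackMachine.PolyTime.tm2ComputableInPolyTime (fun _ => PGA.encodeNats_eq _) (fun _ => rfl)
      (fun A => A.encode_result.trans (PGA.encodeNats_eq _))
      (.tokens_pair (.comp .fst PGA.RationalAutomaton.polyTime_solution)
        (.comp .snd PGA.RationalAutomaton.polyTime_solution)),
    PGA.RationalAutomaton.toENNReal_result⟩
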